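/- Let $m\ge 2$ and consider the billiard on the torus $\mathbb{T}^m=\mathbb{R}^m/\mathbb{Z}^m$ with one obstacle whose lift $O\subset\mathbb{R}^m$ is a compact strictly convex set with nonempty interior and smooth boundary ($C^1$ suffices). For $\mathbf{k}\in\mathbb{Z}^m$ put $O_{\mathbf{k}}=O+\mathbf{k}$. We say that $O_{\mathbf{k}}$ is between $O_{\mathbf{i}}$ and $O_{\mathbf{j}}$ if $\mathbf{k}\ne\mathbf{i},\mathbf{j}$ and $O_{\mathbf{k}}$ intersects the convex hull of $O_{\mathbf{i}}\cup O_{\mathbf{j}}$. A finite sequence $(\mathbf{k}_n)_{n=0}^s$ in $\mathbb{Z}^m$ is admissible if $\mathbf{k}_0=\mathbf{0}$, consecutive terms are distinct, there is no obstacle between $O_{\mathbf{k}_n}$ and $O_{\mathbf{k}_{n+1}}$ ($0\le n<s$), and $O_{\mathbf{k}_{n+1}}$ is not between $O_{\mathbf{k}_n}$ and $O_{\mathbf{k}_{n+2}}$ ($0\le n\le s-2$). A trajectory piece of type $(\mathbf{k}_n)_{n=0}^s$ is a piece of a billiard trajectory in $\mathbb{R}^m$ (outside the interiors of the obstacles)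 that starts on the boundary of $O_{\mathbf{k}_0}$, reflects consecutively from $O_{\mathbf{k}_1},\dots,O_{\mathbf{k}_{s-1}}$, and ends by hitting the boundary of $O_{\mathbf{k}_s}$; a tangency does not count as a reflection, and the piece is not tangent to $O_{\mathbf{k}_0}$ or $O_{\mathbf{k}_s}$ at its endpoints. The admissible rotation set $AR$ is the set of all limits of $(\mathbf{y}_n-\mathbf{x}_n)/t_n$, where there is a trajectory piece of admissible type from $\mathbf{x}_n$ to $\mathbf{y}_n$ of length $t_n$, and $t_n\to\infty$. For $r>0$ let $\eta(r)=\sum_{n=0}^\infty\arcsin\left(r/2^{n-1}\right)$ (a convergent series). For an integer $N>1$ let $\beta(N)$ be the smallest positive angle between nonzero vectors $\mathbf{u},\mathbf{v}\in\mathbb{Z}^d$, $d\ge 1$ arbitrary, of Euclidean norm less than $N$. Let $N(r)$ be the largest integer $N>1$ such that $\eta(r)<\beta(N)/2$, if it exists. Then: (1) If $O$ is contained in a closed ball of radius $r<\sqrt{2}/4$, then $AR$ contains the closed ball centered at $\mathbf{0}$ of radius $(1-\sqrt{2}/2)\cos\eta(r)$. (2) If $O$ is contained in a closed ball of radius $r<\sqrt{2}/4$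 and $N(r)$ is defined, then $AR$ contains the closed ball centered at $\mathbf{0}$ of radius $\frac{N(r)-1}{N(r)+1}\cos(2\eta(r))$. Moreover, $N(r)$ is defined for all sufficiently small $r>0$, and $N(r)\to\infty$ as $r\to 0$. (3) The radius of the largest ball centered at $\mathbf{0}$ and contained in $AR$ tends to $1$, uniformly in $m$, as the diameter of the obstacle tends to $0$. That is, for every $\varepsilon>0$ there is $\delta>0$ such that for every $m\ge 2$ and every obstacle $O\subset\mathbb{R}^m$ as above of diameter less than $\delta$, there is a largest $\rho\ge 0$ such that the closed ball of radius $\rho$ centered at $\mathbf{0}$ is contained in $AR$, and $|\rho-1|<\varepsilon$. -/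

import Mathlib

namespace TorusBilliard

/-- The integer vector `k ∈ ℤ^m`, regarded as a point of Euclidean space `ℝ^m`. -/
noncomputable def intVec {m : ℕ} (k : Fin m → ℤ) : EuclideanSpace ℝ (Fin m) :=
  WithLp.toLp 2 (fun i => (k i : ℝ))

/-- The boundary of `O` is a `C¹` hypersurface: near each of its boundary points, `O` is the
sublevel set of a continuously differentiable function with nonzero differential. -/
def HasC1Boundary {m : ℕ} (O : Set (EuclideanSpace ℝ (Fin m))) : Prop :=
  ∀ x ∈ frontier O, ∃ (V : Set (EuclideanSpace ℝ (Fin m))) (f : EuclideanSpace ℝ (Fin m) → ℝ),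
    IsOpen V ∧ x ∈ V ∧ ContDiffOn ℝ 1 f V ∧ fderiv ℝ f x ≠ 0 ∧
      O ∩ V = {y | y ∈ V ∧ f y ≤ 0}

/-- A (lifted) obstacle: a compact strictly convex body with smooth boundary. -/
structure IsObstacle {m : ℕ} (O : Set (EuclideanSpace ℝ (Fin m))) : Prop where
  isCompact : IsCompact O
  strictConvex : StrictConvex ℝ O
  interior_nonempty : (interior O).Nonempty
  smooth : HasC1Boundary O

/-- The lifted obstacle `O_k = O + k`. -/
noncomputable def lift {m : ℕ} (O : Set (EuclideanSpace ℝ (Fin m))) (k : Fin m → ℤ) :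
    Set (EuclideanSpace ℝ (Fin m)) :=
  (fun x => x + intVec k) '' O

/-- `O_k` is between `O_i` and `O_j`. -/
def IsBetween {m : ℕ} (O : Set (EuclideanSpace ℝ (Fin m))) (k i j : Fin m → ℤ) : Prop :=
  k ≠ i ∧ k ≠ j ∧ (lift O k ∩ convexHull ℝ (lift O i ∪ lift O j)).Nonempty

/-- The finite sequence `k 0, …, k s` is admissible (the values `k n` with `n > s` play no role). -/
structure IsAdmissible {m : ℕ} (O : Set (EuclideanSpace ℝ (Fin m))) (s : ℕ)
    (k : ℕ → (Fin m → ℤ)) : Prop where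
  zero : k 0 = 0
  ne : ∀ n, n + 1 ≤ s → k (n + 1) ≠ k n
  free : ∀ n, n + 1 ≤ s → ∀ j, ¬ IsBetween O j (k n) (k (n + 1))
  turn : ∀ n, n + 2 ≤ s → ¬ IsBetween O (k (n + 1)) (k n) (k (n + 2))

/-- `ν` is an outward unit normal vector of the convex set `C` at its boundary point `x`
(for a convex body with `C¹` boundary it is unique). -/
def IsOutwardUnitNormal {m : ℕ} (C : Set (EuclideanSpace ℝ (Fin m)))
    (x ν : EuclideanSpace ℝ (Fin m)) : Prop :=
  x ∈ frontier C ∧ ‖ν‖ = 1 ∧ ∀ y ∈ C, inner ℝ (y - x) ν ≤ 0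

/-- The unit vector pointing from `a` to `b`. -/
noncomputable def direction {m : ℕ} (a b : EuclideanSpace ℝ (Fin m)) :
    EuclideanSpace ℝ (Fin m) :=
  ‖b - a‖⁻¹ • (b - a)

/-- A particle coming from `a` hits the boundary of `C` at `b` non-tangentially, and is reflected
elastically (angle of incidence = angle of reflection) towards `c`. -/
def Reflects {m : ℕ} (C : Set (EuclideanSpace ℝ (Fin m)))
    (a b c : EuclideanSpace ℝ (Fin m)) : Prop :=
  ∃ ν, IsOutwardUnitNormal C b ν ∧ inner ℝ (direction a b) ν < 0 ∧
    direction b c = direction a b - (2 * inner ℝ (direction a b) ν) • ν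

/-- The polygonal line `x 0, …, x s` is a piece of a billiard trajectory (in the lifting) of type
`k 0, …, k s`: it starts, non-tangentially, at the boundary of `O_{k 0}`, reflects consecutively
from `O_{k 1}, …, O_{k (s-1)}`, hits, non-tangentially, the boundary of `O_{k s}` and ends there;
it never enters the interior of an obstacle. -/
structure IsTrajectoryPiece {m : ℕ} (O : Set (EuclideanSpace ℝ (Fin m))) (s : ℕ)
    (k : ℕ → (Fin m → ℤ)) (x : ℕ → EuclideanSpace ℝ (Fin m)) : Prop where
  mem : ∀ i ≤ s, x i ∈ frontier (lift O (k i))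
  avoid : ∀ i < s, ∀ j, Disjoint (segment ℝ (x i) (x (i + 1))) (interior (lift O j))
  start : 0 < s →
    ∃ ν, IsOutwardUnitNormal (lift O (k 0)) (x 0) ν ∧ 0 < inner ℝ (direction (x 0) (x 1)) ν
  reflects : ∀ i, i + 2 ≤ s → Reflects (lift O (k (i + 1))) (x i) (x (i + 1)) (x (i + 2))
  finish : ∀ i, i + 1 = s →
    ∃ ν, IsOutwardUnitNormal (lift O (k (i + 1))) (x (i + 1)) ν ∧
      inner ℝ (direction (x i) (x (i + 1))) ν < 0

/-- There is a trajectory piece of admissible type from `a` to `b` of length `t`. -/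
def HasAdmissiblePiece {m : ℕ} (O : Set (EuclideanSpace ℝ (Fin m)))
    (a b : EuclideanSpace ℝ (Fin m)) (t : ℝ) : Prop :=
  ∃ (s : ℕ) (k : ℕ → (Fin m → ℤ)) (x : ℕ → EuclideanSpace ℝ (Fin m)),
    IsAdmissible O s k ∧ IsTrajectoryPiece O s k x ∧ x 0 = a ∧ x s = b ∧
      ∑ i ∈ Finset.range s, dist (x i) (x (i + 1)) = t

/-- The admissible rotation set `AR`: all limits of (displacement) / (length) along sequences of
trajectory pieces of admissible type whose lengths tend to infinity. -/
def admissibleRotationSet {m : ℕ} (O : Set (EuclideanSpace ℝ (Fin m))) :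
    Set (EuclideanSpace ℝ (Fin m)) :=
  {u | ∃ (a b : ℕ → EuclideanSpace ℝ (Fin m)) (t : ℕ → ℝ),
    (∀ n, HasAdmissiblePiece O (a n) (b n) (t n)) ∧
    Filter.Tendsto t Filter.atTop Filter.atTop ∧
    Filter.Tendsto (fun n => (t n)⁻¹ • (b n - a n)) Filter.atTop (nhds u)}

/-- `η(r) = ∑_{n ≥ 0} arcsin (r / 2^(n-1))`. -/
noncomputable def eta (r : ℝ) : ℝ :=
  ∑' n : ℕ, Real.arcsin (r / (2 : ℝ) ^ ((n : ℤ) - 1))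

/-- The series defining `η(r)` converges. -/
theorem summable_eta (r : ℝ) :
    Summable fun n : ℕ => Real.arcsin (r / (2 : ℝ) ^ ((n : ℤ) - 1)) := by
  have key : ∀ y : ℝ, 0 ≤ y → Real.arcsin y ≤ Real.pi / 2 * y := by
    intro y hy
    rcases le_total y 1 with h1 | h1
    · have h := Real.mul_le_sin (Real.arcsin_nonneg.2 hy) (Real.arcsin_le_pi_div_two y)
      rw [Real.sin_arcsin (by linarith) h1] at h
      have hp := Real.pi_pos
      have h2 := mul_le_mul_of_nonneg_left h (by positivity : 0 ≤ Real.pi / 2)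
      have h3 : Real.pi / 2 * (2 / Real.pi * Real.arcsin y) = Real.arcsin y := by field_simp
      linarith
    · have hp := Real.pi_pos
      have := Real.arcsin_le_pi_div_two y
      nlinarith
  have key' : ∀ y : ℝ, ‖Real.arcsin y‖ ≤ Real.pi / 2 * |y| := by
    intro y
    rw [Real.norm_eq_abs]
    rcases le_total 0 y with h | h
    · rw [abs_of_nonneg (Real.arcsin_nonneg.2 h), abs_of_nonneg h]
      exact key y h
    · rw [abs_of_nonpos (Real.arcsin_nonpos.2 h), abs_of_nonpos h, ← Real.arcsin_neg]
      exact key (-y) (by linarith)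
  refine Summable.of_norm_bounded
    (g := fun n : ℕ => Real.pi / 2 * (2 * |r|) * (1 / 2 : ℝ) ^ n)
    (summable_geometric_two.mul_left _) (fun n => (key' _).trans (le_of_eq ?_))
  rw [abs_div, abs_of_pos (by positivity : (0 : ℝ) < (2 : ℝ) ^ ((n : ℤ) - 1)),
    zpow_sub_one₀ (by norm_num), zpow_natCast, one_div, inv_pow]
  field_simp

/-- The positive angles between nonzero integer vectors (in any common dimension) of norm less
than `N`. -/
def integerAngles (N : ℕ) : Set ℝ :=
  {θ | 0 < θ ∧ ∃ (m : ℕ) (u v : Fin m → ℤ), u ≠ 0 ∧ v ≠ 0 ∧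
    ‖intVec u‖ < (N : ℝ) ∧ ‖intVec v‖ < (N : ℝ) ∧
    InnerProductGeometry.angle (intVec u) (intVec v) = θ}

/-- `β(N)`, for `N > 1`: the smallest positive angle between nonzero integer vectors of norm less
than `N`; it does not depend on any dimension. -/
noncomputable def beta (N : ℕ) : ℝ := sInf (integerAngles N)

/-- `N(r)` is defined and equal to `N`: `N` is the largest integer `N > 1` with
`η(r) < β(N) / 2`. -/
def IsNOf (r : ℝ) (N : ℕ) : Prop :=
  IsGreatest {n : ℕ | 1 < n ∧ eta r < beta n / 2} N

end TorusBilliard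

namespace TorusBilliard

section

open Finset

/-! ### First-order conditions for shortest paths -/

/-! Trajectories come from Fermat's principle. A shortest broken line visiting the obstacles of an
admissible sequence in order is a trajectory piece (`isTrajectoryPiece_of_min`): first-order
conditions give the reflection law, and admissibility rules out straight passages and foreign
obstacles. When `r < √2 / 4`, any word of free steps whose consecutive members have nonpositive
inner product is admissible, so trajectory pieces can be built by writing words.

Concatenating words adds displacements exactly and minimal lengths up to an error of at most `2 *
r`. Hence the asymptotic pairs (displacement, length) of loops form a closed convex cone, whose
slice at length 1 is convex and lies in the admissible rotation set. By Hahn–Banach a ball lies in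
that slice as soon as the slice reaches far enough in every direction
(`SmallBody.closedBall_subset`).

Two facts provide this reach. First, a free vector `l` gives a point of the slice on its own ray.
Words alternating `l` with the unit steps `-sign (l i) • e_i`, mixed with weights `|l i|`, have
total displacement `(P - 1) • l` and length at most `P * (‖l‖ + 1)`, where `P` is the ℓ¹ norm of
`l`. This speed is at least `1 - √2 / 2` once `‖l‖ ≥ √2`, and at least `(N - 1) / (N + 1)` once `‖l‖
≥ N ≥ 2` (`SmallBody.long_mem_slice`); unit vectors give at least `1 / 2`.

Second, free vectors are nearly dense in direction (`SmallBody.exists_free_angle_le`). If `k` is not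
free, an obstacle in the way gives a roughly half as long vector at a small angle to `k`. Iterating
this descent costs angles that decay geometrically towards longer vectors and sum to at most `η(r)`.
If the free vector found is shorter than `N`, the target is rotated away from it and the search
repeated; two short nonparallel vectors cannot be closer than `β(N)`, so the second one is long, at
total cost `2 η(r)`. None of these bounds depends on the dimension, which gives uniformity in `m`.
-/

lemma deriv_nonneg_of_min {f : ℝ → ℝ} {f' : ℝ} (hf : HasDerivAt f f' 0)
    (h : ∀ t, 0 ≤ t → t ≤ 1 → f 0 ≤ f t) : 0 ≤ f' := by
  have h1 : Filter.Tendsto (slope f 0) (nhdsWithin 0 (Set.Ioi 0)) (nhds f') :=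
    (hasDerivAt_iff_tendsto_slope.1 hf).mono_left
      (nhdsWithin_mono _ fun x hx => ne_of_gt hx)
  refine ge_of_tendsto h1 ?_
  filter_upwards [Ioo_mem_nhdsGT (show (0 : ℝ) < 1 by norm_num)] with t ht
  rw [slope_def_field, sub_zero]
  exact div_nonneg (sub_nonneg.2 (h t ht.1.le ht.2.le)) ht.1.le

lemma hasDerivAt_dist_line {E : Type*} [NormedAddCommGroup E] [InnerProductSpace ℝ E]
    (x v p : E) (hx : x ≠ p) :
    HasDerivAt (fun t : ℝ => dist (x + t • v) p) (inner ℝ (x - p) v / ‖x - p‖) 0 := by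
  have hp : 0 < ‖x - p‖ := norm_pos_iff.2 (sub_ne_zero.2 hx)
  have h0 : HasDerivAt (fun t : ℝ => x + t • v - p) v 0 := by
    simpa using (((hasDerivAt_id (0 : ℝ)).smul_const v).const_add x).sub_const p
  have h1 := h0.norm_sq.sqrt (by simp [hp.ne'])
  simp only [zero_smul, add_zero] at h1
  convert h1 using 1
  · ext t
    rw [dist_eq_norm, Real.sqrt_sq (norm_nonneg _)]
  · rw [Real.sqrt_sq hp.le]
    field_simp

variable {m : ℕ}

lemma norm_direction {a b : EuclideanSpace ℝ (Fin m)} (h : a ≠ b) : ‖direction a b‖ = 1 := by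
  have : ‖b - a‖ ≠ 0 := norm_ne_zero_iff.2 (sub_ne_zero.2 h.symm)
  rw [direction, norm_smul, norm_inv, norm_norm, inv_mul_cancel₀ this]

lemma norm_smul_direction (a b : EuclideanSpace ℝ (Fin m)) :
    ‖b - a‖ • direction a b = b - a := by
  by_cases h : b - a = 0
  · simp [h]
  · rw [direction, smul_smul, mul_inv_cancel₀ (norm_ne_zero_iff.2 h), one_smul]

lemma direction_swap (a b : EuclideanSpace ℝ (Fin m)) : direction a b = -direction b a := by
  rw [direction, direction, norm_sub_rev, ← smul_neg, neg_sub]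

/-- A point where a nonzero functional attains its maximum over `C` is a boundary point. -/
lemma isOutwardUnitNormal_of_inner_le {C : Set (EuclideanSpace ℝ (Fin m))}
    {x ν : EuclideanSpace ℝ (Fin m)} (hx : x ∈ C) (hν : ‖ν‖ = 1)
    (h : ∀ y ∈ C, inner ℝ (y - x) ν ≤ 0) : IsOutwardUnitNormal C x ν := by
  refine ⟨⟨subset_closure hx, fun hi => ?_⟩, hν, h⟩
  have h1 : Filter.Tendsto (fun t : ℝ => x + t • ν) (nhdsWithin 0 (Set.Ioi 0)) (nhds x) := by
    have : Continuous fun t : ℝ => x + t • ν := by fun_prop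
    have h2 := this.tendsto 0
    simp only [zero_smul, add_zero] at h2
    exact h2.mono_left nhdsWithin_le_nhds
  have h2 := h1.eventually (isOpen_interior.mem_nhds hi)
  obtain ⟨t, ht, ht0⟩ := (h2.and self_mem_nhdsWithin).exists
  have h3 := h _ (interior_subset ht)
  rw [add_sub_cancel_left, real_inner_smul_left, real_inner_self_eq_norm_sq, hν] at h3
  have : (0 : ℝ) < t := ht0
  linarith

/-- A segment leaving strictly through a supporting hyperplane stays on its outer side. This keeps a
trajectory out of the two obstacles that it connects. -/
lemma not_mem_interior_of_normal {C : Set (EuclideanSpace ℝ (Fin m))}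
    {x ν y : EuclideanSpace ℝ (Fin m)} (h : IsOutwardUnitNormal C x ν)
    (hy : 0 < inner ℝ (y - x) ν) {p : EuclideanSpace ℝ (Fin m)} (hp : p ∈ segment ℝ x y) :
    p ∉ interior C := by
  rw [segment_eq_image'] at hp
  obtain ⟨t, ⟨ht0, -⟩, rfl⟩ := hp
  rcases ht0.eq_or_lt with rfl | ht
  · simpa using h.1.2
  · intro hi
    have := h.2.2 _ (interior_subset hi)
    simp only [add_sub_cancel_left, real_inner_smul_left] at this
    nlinarith [mul_pos ht hy]

lemma normal_of_dist_min {C : Set (EuclideanSpace ℝ (Fin m))} (hC : Convex ℝ C)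
    {x q : EuclideanSpace ℝ (Fin m)} (hx : x ∈ C) (hxq : x ≠ q)
    (h : ∀ y ∈ C, dist x q ≤ dist y q) : IsOutwardUnitNormal C x (direction x q) := by
  have hp : 0 < ‖x - q‖ := norm_pos_iff.2 (sub_ne_zero.2 hxq)
  refine isOutwardUnitNormal_of_inner_le hx (norm_direction hxq) fun y hy => ?_
  have h1 := deriv_nonneg_of_min (hasDerivAt_dist_line x (y - x) q hxq) (by
    intro t ht0 ht1
    simpa using h _ (hC.add_smul_sub_mem hx hy ⟨ht0, ht1⟩))
  have h2 : 0 ≤ inner ℝ (x - q) (y - x) := by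
    by_contra hn
    exact absurd h1 (not_le.2 (div_neg_of_neg_of_pos (not_le.1 hn) hp))
  rw [direction, real_inner_smul_right, real_inner_comm, ← neg_sub x q, inner_neg_left, norm_neg]
  linarith [mul_nonneg (inv_pos.2 hp).le h2]

/-- The broken line `p x q` of minimal length with vertex in the convex set `C` obeys the
reflection law at `x`, unless it is straight. -/
lemma reflects_of_min {C : Set (EuclideanSpace ℝ (Fin m))} (hC : Convex ℝ C)
    {p x q : EuclideanSpace ℝ (Fin m)} (hx : x ∈ C) (hxp : p ≠ x) (hxq : x ≠ q)
    (hs : x ∉ segment ℝ p q)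
    (h : ∀ y ∈ C, dist p x + dist x q ≤ dist p y + dist y q) :
    ∃ ν, IsOutwardUnitNormal C x ν ∧ inner ℝ (direction p x) ν < 0 ∧
      0 < inner ℝ (direction x q) ν ∧
      direction x q = direction p x - (2 * inner ℝ (direction p x) ν) • ν := by
  set a := direction p x with ha
  set b := direction x q with hb
  have na : ‖a‖ = 1 := norm_direction hxp
  have nb : ‖b‖ = 1 := norm_direction hxq
  -- Equal incoming and outgoing directions would put `x` on the segment `p q`. The normal is
  -- therefore available as the normalised difference `b - a`.
  have hw : b - a ≠ 0 := by
    intro h0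
    have hba : b = a := sub_eq_zero.1 h0
    apply hs
    have h1 : ‖x - p‖ • a = x - p := norm_smul_direction p x
    have h2 : ‖q - x‖ • a = q - x := by rw [← hba]; exact norm_smul_direction x q
    rw [mem_segment_iff_sameRay, ← h1, ← h2]
    exact (SameRay.sameRay_nonneg_smul_left a (norm_nonneg _)).trans
      (SameRay.sameRay_nonneg_smul_right a (norm_nonneg _))
      (fun h => by simp [h] at na)
  set c := ‖b - a‖ with hc
  have hcp : 0 < c := norm_pos_iff.2 hw
  have hcc : c ^ 2 = 2 - 2 * inner ℝ a b := by
    rw [hc, norm_sub_sq_real, na, nb, real_inner_comm]; ring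
  have hder : ∀ y ∈ C, inner ℝ (y - x) (b - a) ≤ 0 := by
    intro y hy
    have h1 := deriv_nonneg_of_min ((hasDerivAt_dist_line x (y - x) p hxp.symm).add
      (hasDerivAt_dist_line x (y - x) q hxq)) (by
      intro t ht0 ht1
      have := h _ (hC.add_smul_sub_mem hx hy ⟨ht0, ht1⟩)
      rw [dist_comm p, dist_comm p] at this
      simpa using this)
    have e1 : inner ℝ (x - p) (y - x) / ‖x - p‖ = inner ℝ (y - x) a := by
      rw [ha, direction, real_inner_smul_right, real_inner_comm]; ring
    have e2 : inner ℝ (x - q) (y - x) / ‖x - q‖ = - inner ℝ (y - x) b := by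
      rw [hb, direction, real_inner_smul_right, real_inner_comm, ← neg_sub q x, inner_neg_right,
        norm_neg]
      ring
    rw [e1, e2] at h1
    rw [inner_sub_right]
    linarith
  have hν : ‖c⁻¹ • (b - a)‖ = 1 := by
    rw [norm_smul, norm_inv, Real.norm_of_nonneg hcp.le, ← hc, inv_mul_cancel₀ hcp.ne']
  have hin : inner ℝ a (c⁻¹ • (b - a)) = -(c / 2) := by
    rw [real_inner_smul_right, inner_sub_right, real_inner_self_eq_norm_sq, na]
    field_simp
    linarith
  have hin' : inner ℝ b (c⁻¹ • (b - a)) = c / 2 := by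
    rw [real_inner_smul_right, inner_sub_right, real_inner_self_eq_norm_sq, nb, real_inner_comm]
    field_simp
    linarith
  refine ⟨c⁻¹ • (b - a), isOutwardUnitNormal_of_inner_le hx hν fun y hy => ?_, ?_, ?_, ?_⟩
  · rw [real_inner_smul_right]
    exact mul_nonpos_of_nonneg_of_nonpos (inv_pos.2 hcp).le (hder y hy)
  · rw [hin]; linarith
  · rw [hin']; linarith
  · rw [hin, smul_smul]
    have : 2 * -(c / 2) * c⁻¹ = -1 := by field_simp
    rw [this]
    simp

/-! ### Path length -/

/-- The length of the polygonal line `x 0, …, x s`. -/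
noncomputable def pathLen (x : ℕ → EuclideanSpace ℝ (Fin m)) (s : ℕ) : ℝ :=
  ∑ i ∈ range s, dist (x i) (x (i + 1))

/-- Moving one vertex changes only the adjacent terms of the length. This and the next two lemmas
turn global minimality of a path into minimality in each vertex separately. -/
lemma pathLen_update_zero (x : ℕ → EuclideanSpace ℝ (Fin m)) (s : ℕ)
    (y : EuclideanSpace ℝ (Fin m)) :
    pathLen (Function.update x 0 y) (s + 1) - dist y (x 1) = pathLen x (s + 1) - dist (x 0) (x 1) := by
  simp only [pathLen, sum_range_succ']
  simp [Function.update_of_ne]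

lemma pathLen_update_last (x : ℕ → EuclideanSpace ℝ (Fin m)) (s : ℕ)
    (y : EuclideanSpace ℝ (Fin m)) :
    pathLen (Function.update x (s + 1) y) (s + 1) - dist (x s) y =
      pathLen x (s + 1) - dist (x s) (x (s + 1)) := by
  simp only [pathLen, sum_range_succ]
  rw [Function.update_self, Function.update_of_ne (by omega), add_sub_cancel_right,
    add_sub_cancel_right]
  refine sum_congr rfl fun i hi => ?_
  rw [mem_range] at hi
  rw [Function.update_of_ne (by omega), Function.update_of_ne (by omega)]

lemma pathLen_update_succ (x : ℕ → EuclideanSpace ℝ (Fin m)) {s i : ℕ} (hi : i + 2 ≤ s)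
    (y : EuclideanSpace ℝ (Fin m)) :
    pathLen (Function.update x (i + 1) y) s - (dist (x i) y + dist y (x (i + 2))) =
      pathLen x s - (dist (x i) (x (i + 1)) + dist (x (i + 1)) (x (i + 2))) := by
  have h1 : i ∈ range s := by simp; omega
  have h2 : i + 1 ∈ (range s).erase i := by simp; omega
  simp only [pathLen]
  rw [← add_sum_erase _ _ h1, ← add_sum_erase _ _ h2, ← add_sum_erase (range s) _ h1,
    ← add_sum_erase _ (fun j => dist (x j) (x (j + 1))) h2]
  have h3 : ∑ j ∈ ((range s).erase i).erase (i + 1),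
      dist (Function.update x (i + 1) y j) (Function.update x (i + 1) y (j + 1)) =
      ∑ j ∈ ((range s).erase i).erase (i + 1), dist (x j) (x (j + 1)) := by
    refine sum_congr rfl fun j hj => ?_
    simp only [mem_erase, mem_range] at hj
    rw [Function.update_of_ne (by omega), Function.update_of_ne (by omega)]
  rw [h3, Function.update_self, Function.update_of_ne (by omega : i ≠ i + 1),
    Function.update_of_ne (by omega : i + 1 + 1 ≠ i + 1)]
  ring

/-- If the lifts are pairwise disjoint, then a shortest path visiting the obstacles of an admissible
sequence is a trajectory piece. -/
theorem isTrajectoryPiece_of_min {O : Set (EuclideanSpace ℝ (Fin m))} (hO : Convex ℝ O) {s : ℕ}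
    {k : ℕ → (Fin m → ℤ)} (hs : 0 < s) (hk : IsAdmissible O s k)
    (hdisj : ∀ i j, i ≠ j → Disjoint (lift O i) (lift O j))
    {x : ℕ → EuclideanSpace ℝ (Fin m)} (hx : ∀ i, x i ∈ lift O (k i))
    (hmin : ∀ y : ℕ → EuclideanSpace ℝ (Fin m), (∀ i, y i ∈ lift O (k i)) →
      pathLen x s ≤ pathLen y s) : IsTrajectoryPiece O s k x := by
  have hconv : ∀ j, Convex ℝ (lift O j) := fun j => by
    have := hO.translate (intVec j)
    simpa [lift, add_comm] using this
  have hne : ∀ i, i < s → x i ≠ x (i + 1) := fun i hi h =>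
    Set.disjoint_left.1 (hdisj _ _ (hk.ne i hi)) (hx (i + 1)) (h ▸ hx i)
  have hupd : ∀ i y, y ∈ lift O (k i) → ∀ j, Function.update x i y j ∈ lift O (k j) := by
    intro i y hy j
    by_cases h : j = i
    · subst h; simpa using hy
    · rw [Function.update_of_ne h]; exact hx j
  have hstart : IsOutwardUnitNormal (lift O (k 0)) (x 0) (direction (x 0) (x 1)) := by
    refine normal_of_dist_min (hconv _) (hx 0) (hne 0 hs) fun y hy => ?_
    obtain ⟨s, rfl⟩ := Nat.exists_eq_succ_of_ne_zero hs.ne'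
    have h1 := hmin _ (hupd 0 y hy)
    have h2 := pathLen_update_zero x s y
    simp only [Nat.succ_eq_add_one] at h1
    linarith
  have hfin : ∀ i, i + 1 = s →
      IsOutwardUnitNormal (lift O (k (i + 1))) (x (i + 1)) (direction (x (i + 1)) (x i)) := by
    rintro i rfl
    refine normal_of_dist_min (hconv _) (hx _) (hne i (by omega)).symm fun y hy => ?_
    have h1 := hmin _ (hupd (i + 1) y hy)
    have h2 := pathLen_update_last x i y
    rw [dist_comm (x (i + 1)), dist_comm y]
    linarith
  have hrefl : ∀ i, i + 2 ≤ s → ∃ ν, IsOutwardUnitNormal (lift O (k (i + 1))) (x (i + 1)) ν ∧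
      inner ℝ (direction (x i) (x (i + 1))) ν < 0 ∧
      0 < inner ℝ (direction (x (i + 1)) (x (i + 2))) ν ∧
      direction (x (i + 1)) (x (i + 2)) = direction (x i) (x (i + 1)) -
        (2 * inner ℝ (direction (x i) (x (i + 1))) ν) • ν := by
    intro i hi
    refine reflects_of_min (hconv _) (hx _) (hne i (by omega)) (hne (i + 1) (by omega)) ?_ ?_
    -- The turn condition of admissibility is used here: a straight passage would put `O_{k (i+1)}`
    -- between its two neighbours.
    · intro hseg
      refine hk.turn i hi ⟨hk.ne i (by omega), (hk.ne (i + 1) (by omega)).symm, _, hx (i + 1), ?_⟩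
      exact segment_subset_convexHull (Set.mem_union_left _ (hx i))
        (Set.mem_union_right _ (hx (i + 2))) hseg
    · intro y hy
      have h1 := hmin _ (hupd (i + 1) y hy)
      have h2 := pathLen_update_succ x hi y
      linarith
  have hself : ∀ i, i < s → inner ℝ (direction (x i) (x (i + 1))) (direction (x i) (x (i + 1))) =
      (1 : ℝ) := fun i hi => by
    rw [real_inner_self_eq_norm_sq, norm_direction (hne i hi), one_pow]
  -- outward normals at both ends of each segment
  have hout : ∀ i, i < s → ∃ ν, IsOutwardUnitNormal (lift O (k i)) (x i) ν ∧
      0 < inner ℝ (direction (x i) (x (i + 1))) ν := by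
    intro i hi
    rcases i with _ | i
    · exact ⟨_, hstart, by rw [zero_add, hself 0 hi]; norm_num⟩
    · obtain ⟨ν, h1, -, h3, -⟩ := hrefl i (by omega)
      exact ⟨ν, h1, h3⟩
  have hinn : ∀ i, i < s → ∃ ν, IsOutwardUnitNormal (lift O (k (i + 1))) (x (i + 1)) ν ∧
      inner ℝ (direction (x i) (x (i + 1))) ν < 0 := by
    intro i hi
    rcases Nat.lt_or_ge (i + 1) s with h | h
    · obtain ⟨ν, h1, h2, -, -⟩ := hrefl i (by omega)
      exact ⟨ν, h1, h2⟩
    · refine ⟨_, hfin i (by omega), ?_⟩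
      rw [direction_swap (x (i + 1)), inner_neg_right, hself i hi]; norm_num
  have hpos : ∀ i, i < s → 0 < ‖x (i + 1) - x i‖ := fun i hi =>
    norm_pos_iff.2 (sub_ne_zero.2 (hne i hi).symm)
  refine ⟨?_, ?_, fun hs => hout 0 hs, ?_, ?_⟩
  · intro i hi
    rcases hi.lt_or_eq with h | h
    · obtain ⟨ν, h1, -⟩ := hout i h
      exact h1.1
    · rcases i with _ | i
      · exact hstart.1
      · exact (hfin i h).1
  · intro i hi j
    rw [Set.disjoint_left]
    intro p hp hpj
    by_cases hj : j = k i
    · subst hj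
      obtain ⟨ν, h1, h2⟩ := hout i hi
      refine not_mem_interior_of_normal h1 ?_ hp hpj
      rw [← norm_smul_direction, real_inner_smul_left]
      exact mul_pos (hpos i hi) h2
    by_cases hj' : j = k (i + 1)
    · subst hj'
      obtain ⟨ν, h1, h2⟩ := hinn i hi
      refine not_mem_interior_of_normal h1 ?_ (by rwa [segment_symm]) hpj
      rw [← neg_sub, inner_neg_left, ← norm_smul_direction, real_inner_smul_left]
      have := mul_neg_of_pos_of_neg (hpos i hi) h2
      linarith
    · refine hk.free i hi j ⟨hj, hj', p, interior_subset hpj, ?_⟩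
      exact segment_subset_convexHull (Set.mem_union_left _ (hx i))
        (Set.mem_union_right _ (hx (i + 1))) hp
  · intro i hi
    obtain ⟨ν, h1, h2, -, h4⟩ := hrefl i hi
    exact ⟨ν, h1, h2, h4⟩
  · rintro i rfl
    exact hinn i (by omega)

end

section

open Finset

variable {m : ℕ}

/-! ### Integer vectors -/

@[simp] lemma intVec_apply (u : Fin m → ℤ) (i : Fin m) : intVec u i = (u i : ℝ) := rfl

@[simp] lemma intVec_zero : intVec (0 : Fin m → ℤ) = 0 := by
  ext i; simp

lemma intVec_add (u v : Fin m → ℤ) : intVec (u + v) = intVec u + intVec v := by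
  ext i; simp

lemma intVec_neg (u : Fin m → ℤ) : intVec (-u) = -intVec u := by
  ext i; simp

lemma intVec_sub (u v : Fin m → ℤ) : intVec (u - v) = intVec u - intVec v := by
  ext i; simp

lemma intVec_zsmul (n : ℤ) (v : Fin m → ℤ) : intVec (n • v) = (n : ℝ) • intVec v := by
  ext i; simp

lemma inner_intVec (u v : Fin m → ℤ) : inner ℝ (intVec u) (intVec v) = ((u ⬝ᵥ v : ℤ) : ℝ) := by
  simp [PiLp.inner_apply, dotProduct, mul_comm]

lemma norm_intVec_sq (u : Fin m → ℤ) : ‖intVec u‖ ^ 2 = ((u ⬝ᵥ u : ℤ) : ℝ) := by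
  rw [← real_inner_self_eq_norm_sq, inner_intVec]

lemma dotProduct_self_nonneg (u : Fin m → ℤ) : 0 ≤ u ⬝ᵥ u :=
  Finset.sum_nonneg fun i _ => mul_self_nonneg (u i)

lemma one_le_dotProduct_self {u : Fin m → ℤ} (hu : u ≠ 0) : 1 ≤ u ⬝ᵥ u := by
  have h1 := dotProduct_self_nonneg u
  have h2 : u ⬝ᵥ u ≠ 0 := fun h => hu (dotProduct_self_eq_zero.1 h)
  omega

lemma one_le_norm_intVec {u : Fin m → ℤ} (hu : u ≠ 0) : 1 ≤ ‖intVec u‖ := by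
  have h1 : (1 : ℝ) ≤ ‖intVec u‖ ^ 2 := by
    rw [norm_intVec_sq]; exact_mod_cast one_le_dotProduct_self hu
  nlinarith [norm_nonneg (intVec u)]

lemma intVec_ne_zero {u : Fin m → ℤ} (hu : u ≠ 0) : intVec u ≠ 0 :=
  norm_pos_iff.1 (zero_lt_one.trans_le (one_le_norm_intVec hu))

lemma norm_intVec_of_unit {l : Fin m → ℤ} (hl : l ⬝ᵥ l = 1) : ‖intVec l‖ = 1 := by
  have := norm_intVec_sq l
  rw [hl, Int.cast_one] at this
  exact (pow_eq_one_iff_of_nonneg (norm_nonneg _) two_ne_zero).1 this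

/-! ### Obstacles inside a small ball -/

lemma mem_lift_iff {O : Set (EuclideanSpace ℝ (Fin m))} {k : Fin m → ℤ}
    {x : EuclideanSpace ℝ (Fin m)} : x ∈ lift O k ↔ x - intVec k ∈ O := by
  constructor
  · rintro ⟨y, hy, rfl⟩
    simpa using hy
  · intro h
    exact ⟨_, h, by simp⟩

/-- A convex body contained in a closed ball of radius `r < √2 / 4`, whose translates by distinct
integer vectors are therefore disjoint. -/
structure SmallBody (O : Set (EuclideanSpace ℝ (Fin m))) (z : EuclideanSpace ℝ (Fin m))
    (r : ℝ) : Prop where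
  isCompact : IsCompact O
  convex : Convex ℝ O
  nonempty : O.Nonempty
  lt : r < √2 / 4
  subset : O ⊆ Metric.closedBall z r

namespace SmallBody

variable {O : Set (EuclideanSpace ℝ (Fin m))} {z : EuclideanSpace ℝ (Fin m)} {r : ℝ}

lemma radius_nonneg (h : SmallBody O z r) : 0 ≤ r := by
  obtain ⟨x, hx⟩ := h.nonempty
  exact dist_nonneg.trans (h.subset hx)

lemma four_mul_sq_lt (h : SmallBody O z r) : 4 * r ^ 2 < 1 / 2 := by
  have h1 := h.radius_nonneg
  have h2 := h.lt
  nlinarith [Real.sq_sqrt (show (0 : ℝ) ≤ 2 by norm_num), Real.sqrt_nonneg 2]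

lemma norm_sub_center_le (h : SmallBody O z r) {k : Fin m → ℤ} {x : EuclideanSpace ℝ (Fin m)}
    (hx : x ∈ lift O k) : ‖x - (z + intVec k)‖ ≤ r := by
  have := h.subset (mem_lift_iff.1 hx)
  rwa [mem_closedBall_iff_norm, sub_sub, add_comm] at this

lemma norm_sub_sub_le (h : SmallBody O z r) {k l : Fin m → ℤ} {x y : EuclideanSpace ℝ (Fin m)}
    (hx : x ∈ lift O k) (hy : y ∈ lift O l) : ‖(x - y) - intVec (k - l)‖ ≤ 2 * r := by
  have e : (x - y) - intVec (k - l) = (x - (z + intVec k)) - (y - (z + intVec l)) := by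
    rw [intVec_sub]; abel
  rw [e]
  linarith [norm_sub_le (x - (z + intVec k)) (y - (z + intVec l)), h.norm_sub_center_le hx,
    h.norm_sub_center_le hy]

lemma disjoint_lift (h : SmallBody O z r) {i j : Fin m → ℤ} (hij : i ≠ j) :
    Disjoint (lift O i) (lift O j) := by
  rw [Set.disjoint_left]
  intro x hx hy
  have h1 := h.norm_sub_sub_le hx hy
  have h2 := one_le_norm_intVec (sub_ne_zero.2 hij)
  rw [sub_self, zero_sub, norm_neg] at h1
  nlinarith [h.four_mul_sq_lt, h.radius_nonneg]

open scoped Pointwise in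
/-- If `O_j` is between `O_i` and `O_k`, then `j` is within `2 r` of the segment from `i` to `k`. -/
lemma exists_norm_le_of_isBetween (h : SmallBody O z r) {i j k : Fin m → ℤ}
    (hb : IsBetween O j i k) :
    ∃ t : ℝ, 0 ≤ t ∧ t ≤ 1 ∧ ‖intVec (j - i) - t • intVec (k - i)‖ ≤ 2 * r := by
  obtain ⟨-, -, y, hyj, hy⟩ := hb
  -- The closed `r`-neighbourhood of the segment joining the two centres is convex and contains both
  -- obstacles.
  have hsub : convexHull ℝ (lift O i ∪ lift O k) ⊆
      segment ℝ (z + intVec i) (z + intVec k) + Metric.closedBall (0 : EuclideanSpace ℝ (Fin m)) r := by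
    refine convexHull_min (Set.union_subset ?_ ?_)
      ((convex_segment _ _).add (convex_closedBall _ _))
    · intro x hx
      refine ⟨_, left_mem_segment ℝ _ _, x - (z + intVec i), ?_, by simp⟩
      simpa using h.norm_sub_center_le hx
    · intro x hx
      refine ⟨_, right_mem_segment ℝ _ _, x - (z + intVec k), ?_, by simp⟩
      simpa using h.norm_sub_center_le hx
  obtain ⟨p, hp, q, hq, rfl⟩ := hsub hy
  rw [segment_eq_image'] at hp
  obtain ⟨t, ⟨ht0, ht1⟩, rfl⟩ := hp
  refine ⟨t, ht0, ht1, ?_⟩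
  have h1 := h.norm_sub_center_le hyj
  have h2 : ‖q‖ ≤ r := by simpa using hq
  have e : intVec (j - i) - t • intVec (k - i) =
      q - (z + intVec i + t • (z + intVec k - (z + intVec i)) + q - (z + intVec j)) := by
    simp only [intVec_sub, smul_sub, smul_add]; abel
  rw [e]
  refine (norm_sub_le _ _).trans ?_
  linarith

end SmallBody

/-- There is no obstacle between `O_0` and `O_l` (nor between any translates of these two). -/
def Free (O : Set (EuclideanSpace ℝ (Fin m))) (l : Fin m → ℤ) : Prop :=
  l ≠ 0 ∧ ∀ i j, ¬ IsBetween O j i (i + l)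

namespace SmallBody

variable {O : Set (EuclideanSpace ℝ (Fin m))} {z : EuclideanSpace ℝ (Fin m)} {r : ℝ}

/-- This is where `√2 / 4` enters. Since `l ⬝ᵥ e ≤ 0` and both norms are at least 1, the squared
distance from the middle centre to any point of the outer segment is at least `(1 - t) ^ 2 + t ^ 2 ≥
1 / 2`, whereas betweenness would make it at most `4 * r ^ 2 < 1 / 2`. -/
lemma not_isBetween_of_dotProduct_nonpos (h : SmallBody O z r) {l e : Fin m → ℤ} (hl : l ≠ 0)
    (he : e ≠ 0) (hle : l ⬝ᵥ e ≤ 0) (i : Fin m → ℤ) : ¬ IsBetween O (i + l) i (i + l + e) := by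
  intro hb
  obtain ⟨t, ht0, ht1, ht⟩ := h.exists_norm_le_of_isBetween hb
  have e1 : intVec (i + l - i) - t • intVec (i + l + e - i) =
      (1 - t) • intVec l - t • intVec e := by
    simp only [intVec_sub, intVec_add, sub_smul, one_smul, smul_sub, smul_add]; abel
  rw [e1] at ht
  have hsq : ‖(1 - t) • intVec l - t • intVec e‖ ^ 2 ≤ (2 * r) ^ 2 :=
    pow_le_pow_left₀ (norm_nonneg _) ht 2
  rw [norm_sub_sq_real, norm_smul, norm_smul, mul_pow, mul_pow, real_inner_smul_left,
    real_inner_smul_right, inner_intVec, norm_intVec_sq, norm_intVec_sq, Real.norm_eq_abs,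
    Real.norm_eq_abs, sq_abs, sq_abs] at hsq
  have a1 : (1 : ℝ) ≤ ((l ⬝ᵥ l : ℤ) : ℝ) := by exact_mod_cast one_le_dotProduct_self hl
  have a2 : (1 : ℝ) ≤ ((e ⬝ᵥ e : ℤ) : ℝ) := by exact_mod_cast one_le_dotProduct_self he
  have a3 : ((l ⬝ᵥ e : ℤ) : ℝ) ≤ 0 := by exact_mod_cast hle
  have b1 := mul_le_mul_of_nonneg_left a1 (sq_nonneg (1 - t))
  have b2 := mul_le_mul_of_nonneg_left a2 (sq_nonneg t)
  have b3 := mul_nonneg (mul_nonneg (sub_nonneg.2 ht1) ht0) (neg_nonneg.2 a3)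
  nlinarith [h.four_mul_sq_lt, sq_nonneg (2 * t - 1)]

/-- If some obstacle is between `O_i` and `O_{i+k}`, then some nonzero integer vector `l`, at most
half as long as `k` in the direction of `k`, is within `2 r` of the line spanned by `k`. -/
lemma exists_halfway (h : SmallBody O z r) {k : Fin m → ℤ} (hk : k ≠ 0) (hf : ¬ Free O k) :
    ∃ l : Fin m → ℤ, 0 < l ⬝ᵥ k ∧ 2 * (l ⬝ᵥ k) ≤ k ⬝ᵥ k ∧
      ((l ⬝ᵥ l : ℤ) : ℝ) * (k ⬝ᵥ k : ℤ) - ((l ⬝ᵥ k : ℤ) : ℝ) ^ 2 ≤ 4 * r ^ 2 * (k ⬝ᵥ k : ℤ) := by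
  simp only [Free, not_and, not_forall, not_not] at hf
  obtain ⟨i, j, hb⟩ := hf hk
  obtain ⟨t, ht0, ht1, ht⟩ := h.exists_norm_le_of_isBetween hb
  have hji : j - i ≠ 0 := sub_ne_zero.2 hb.1
  have hjk : j - i - k ≠ 0 := by
    have := sub_ne_zero.2 hb.2.1
    rwa [← sub_sub] at this
  rw [add_sub_cancel_left] at ht
  generalize j - i = l at hji hjk ht
  have hsq : ‖intVec l - t • intVec k‖ ^ 2 ≤ (2 * r) ^ 2 := pow_le_pow_left₀ (norm_nonneg _) ht 2
  rw [norm_sub_sq_real, norm_smul, mul_pow, real_inner_smul_right, inner_intVec, norm_intVec_sq,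
    norm_intVec_sq, Real.norm_eq_abs, sq_abs] at hsq
  have e3 : (l - k) ⬝ᵥ (l - k) = l ⬝ᵥ l - 2 * (l ⬝ᵥ k) + k ⬝ᵥ k := by
    simp only [sub_dotProduct, dotProduct_sub, dotProduct_comm k l]; ring
  have e4 : (k - l) ⬝ᵥ (k - l) = l ⬝ᵥ l - 2 * (l ⬝ᵥ k) + k ⬝ᵥ k := by
    simp only [sub_dotProduct, dotProduct_sub, dotProduct_comm k l]; ring
  have e5 : (k - l) ⬝ᵥ k = k ⬝ᵥ k - l ⬝ᵥ k := sub_dotProduct _ _ _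
  have a1 := one_le_dotProduct_self hji
  have a2 := one_le_dotProduct_self hjk
  have a3 := one_le_dotProduct_self hk
  rw [e3] at a2
  have h4 := h.four_mul_sq_lt
  have key : 0 < l ⬝ᵥ k ∧ l ⬝ᵥ k < k ⬝ᵥ k ∧ ((l ⬝ᵥ l : ℤ) : ℝ) * (k ⬝ᵥ k : ℤ) -
      ((l ⬝ᵥ k : ℤ) : ℝ) ^ 2 ≤ 4 * r ^ 2 * (k ⬝ᵥ k : ℤ) := by
    refine ⟨?_, ?_, ?_⟩
    · by_contra hc
      have c1 : ((l ⬝ᵥ k : ℤ) : ℝ) ≤ 0 := by exact_mod_cast not_lt.1 hc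
      have c2 : (1 : ℝ) ≤ ((l ⬝ᵥ l : ℤ) : ℝ) := by exact_mod_cast a1
      have c3 : (1 : ℝ) ≤ ((k ⬝ᵥ k : ℤ) : ℝ) := by exact_mod_cast a3
      nlinarith [mul_nonneg ht0 (neg_nonneg.2 c1), mul_nonneg (sq_nonneg t) (zero_le_one.trans c3)]
    · by_contra hc
      have c1 : ((k ⬝ᵥ k : ℤ) : ℝ) ≤ ((l ⬝ᵥ k : ℤ) : ℝ) := by exact_mod_cast not_lt.1 hc
      have c2 : (1 : ℝ) ≤ ((l ⬝ᵥ l : ℤ) : ℝ) - 2 * (l ⬝ᵥ k : ℤ) + (k ⬝ᵥ k : ℤ) := by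
        exact_mod_cast a2
      have c3 : (1 : ℝ) ≤ ((k ⬝ᵥ k : ℤ) : ℝ) := by exact_mod_cast a3
      nlinarith [mul_nonneg (sub_nonneg.2 ht1) (sub_nonneg.2 c1),
        mul_nonneg (sq_nonneg (1 - t)) (zero_le_one.trans c3)]
    · have c3 : (1 : ℝ) ≤ ((k ⬝ᵥ k : ℤ) : ℝ) := by exact_mod_cast a3
      generalize ((k ⬝ᵥ k : ℤ) : ℝ) = a at *
      generalize ((l ⬝ᵥ k : ℤ) : ℝ) = c at *
      nlinarith [mul_le_mul_of_nonneg_right hsq (zero_le_one.trans c3), sq_nonneg (t * a - c)]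
  -- The map `l ↦ k - l` preserves the distance to the line through `k`, so the projection can be
  -- placed in the first half.
  obtain ⟨k1, k2, k3⟩ := key
  rcases le_total (2 * (l ⬝ᵥ k)) (k ⬝ᵥ k) with hle | hle
  · exact ⟨l, k1, hle, k3⟩
  · refine ⟨k - l, by rw [e5]; linarith, by rw [e5]; linarith, ?_⟩
    rw [e4, e5]
    push_cast
    linarith

lemma free_of_dotProduct_self_eq_one (h : SmallBody O z r) {k : Fin m → ℤ} (hk : k ⬝ᵥ k = 1) :
    Free O k := by
  by_contra hf
  obtain ⟨l, h1, h2, -⟩ := h.exists_halfway (by rintro rfl; simp at hk) hf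
  omega

end SmallBody

end

section

open Finset

variable {m : ℕ}

/-! ### Words of steps -/

/-- The position after the first `n` steps of the word `w`. -/
def vertex (w : List (Fin m → ℤ)) (n : ℕ) : Fin m → ℤ := (w.take n).sum

lemma vertex_zero (w : List (Fin m → ℤ)) : vertex w 0 = 0 := by simp [vertex]

lemma vertex_of_length_le {w : List (Fin m → ℤ)} {n : ℕ} (h : w.length ≤ n) :
    vertex w n = w.sum := by
  rw [vertex, List.take_of_length_le h]

lemma vertex_succ (w : List (Fin m → ℤ)) {n : ℕ} (h : n < w.length) :
    vertex w (n + 1) = vertex w n + w[n] := List.sum_take_succ w n h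

lemma vertex_cons_succ (l : Fin m → ℤ) (w : List (Fin m → ℤ)) (n : ℕ) :
    vertex (l :: w) (n + 1) = l + vertex w n := by simp [vertex]

lemma vertex_append_of_le (w w' : List (Fin m → ℤ)) {n : ℕ} (h : n ≤ w.length) :
    vertex (w ++ w') n = vertex w n := by
  rw [vertex, vertex, List.take_append_of_le_length h]

lemma vertex_append_add (w w' : List (Fin m → ℤ)) (n : ℕ) :
    vertex (w ++ w') (w.length + n) = w.sum + vertex w' n := by
  simp [vertex, List.take_append, List.take_of_length_le]

/-- The steps of the word connect obstacles with nothing in between, and consecutive steps do not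
make an acute angle. -/
structure Valid (O : Set (EuclideanSpace ℝ (Fin m))) (w : List (Fin m → ℤ)) : Prop where
  free : ∀ l ∈ w, Free O l
  chain : w.IsChain fun l e => l ⬝ᵥ e ≤ 0

variable {O : Set (EuclideanSpace ℝ (Fin m))} {z : EuclideanSpace ℝ (Fin m)} {r : ℝ}

lemma Valid.append {w w' : List (Fin m → ℤ)} (h : Valid O w) (h' : Valid O w')
    (hc : ∀ l ∈ w.getLast?, ∀ e ∈ w'.head?, l ⬝ᵥ e ≤ 0) : Valid O (w ++ w') := by
  refine ⟨fun l hl => ?_, List.isChain_append.2 ⟨h.chain, h'.chain, hc⟩⟩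
  rcases List.mem_append.1 hl with hl | hl
  · exact h.free l hl
  · exact h'.free l hl

lemma Valid.isAdmissible (hO : SmallBody O z r) {w : List (Fin m → ℤ)} (h : Valid O w) :
    IsAdmissible O w.length (vertex w) := by
  refine ⟨vertex_zero w, fun n hn => ?_, fun n hn j => ?_, fun n hn => ?_⟩
  · rw [vertex_succ w hn]
    simpa using (h.free _ (List.getElem_mem hn)).1
  · rw [vertex_succ w hn]
    exact (h.free _ (List.getElem_mem hn)).2 _ _
  · rw [vertex_succ w (show n + 1 < w.length by omega), vertex_succ w (show n < w.length by omega)]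
    exact hO.not_isBetween_of_dotProduct_nonpos (h.free _ (List.getElem_mem _)).1
      (h.free _ (List.getElem_mem _)).1 (List.isChain_iff_getElem.1 h.chain n hn) _

/-! ### Shortest paths along a word -/

/-- `x` visits the obstacles `O_{k_n}`, where `k_n` are the positions along the word `w`. -/
def IsPath (O : Set (EuclideanSpace ℝ (Fin m))) (w : List (Fin m → ℤ))
    (x : ℕ → EuclideanSpace ℝ (Fin m)) : Prop := ∀ i, x i ∈ lift O (vertex w i)

/-- The minimal length of a path visiting the obstacles along the word `w`. -/
noncomputable def minLen (O : Set (EuclideanSpace ℝ (Fin m))) (w : List (Fin m → ℤ)) : ℝ :=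
  sInf ((fun x => pathLen x w.length) '' {x | IsPath O w x})

lemma pathLen_nonneg (x : ℕ → EuclideanSpace ℝ (Fin m)) (s : ℕ) : 0 ≤ pathLen x s :=
  sum_nonneg fun _ _ => dist_nonneg

lemma minLen_le {w : List (Fin m → ℤ)} {x : ℕ → EuclideanSpace ℝ (Fin m)} (hx : IsPath O w x) :
    minLen O w ≤ pathLen x w.length := by
  refine csInf_le ⟨0, ?_⟩ ⟨x, hx, rfl⟩
  rintro _ ⟨y, -, rfl⟩
  exact pathLen_nonneg _ _

/-- By Tychonoff: the paths form a product of compact sets, and the length depends continuously on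
finitely many coordinates. -/
lemma SmallBody.exists_pathLen_eq_minLen (hO : SmallBody O z r) (w : List (Fin m → ℤ)) :
    ∃ x, IsPath O w x ∧ pathLen x w.length = minLen O w := by
  have hcomp : IsCompact {x | IsPath O w x} := by
    have h1 : ∀ i, IsCompact (lift O (vertex w i)) := fun i =>
      hO.isCompact.image (by fun_prop)
    have := isCompact_univ_pi h1
    convert this using 1
    ext x
    simp [IsPath]
  have hne : {x | IsPath O w x}.Nonempty := by
    obtain ⟨p, hp⟩ := hO.nonempty
    exact ⟨fun i => p + intVec (vertex w i), fun i => ⟨p, hp, rfl⟩⟩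
  have hcont : Continuous fun x : ℕ → EuclideanSpace ℝ (Fin m) => pathLen x w.length := by
    unfold pathLen
    fun_prop
  obtain ⟨x, hx, h⟩ := hcomp.exists_sInf_image_eq hne hcont.continuousOn
  exact ⟨x, hx, h.symm⟩

lemma minLen_nonneg (w : List (Fin m → ℤ)) : 0 ≤ minLen O w := by
  refine Real.sInf_nonneg ?_
  rintro _ ⟨y, -, rfl⟩
  exact pathLen_nonneg _ _

lemma pathLen_add (x : ℕ → EuclideanSpace ℝ (Fin m)) (a b : ℕ) :
    pathLen x (a + b) = pathLen x a + pathLen (fun i => x (a + i)) b :=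
  sum_range_add _ _ _

lemma pathLen_congr {x y : ℕ → EuclideanSpace ℝ (Fin m)} {s : ℕ} (h : ∀ i ≤ s, x i = y i) :
    pathLen x s = pathLen y s := by
  refine sum_congr rfl fun i hi => ?_
  rw [mem_range] at hi
  rw [h i hi.le, h (i + 1) hi]

lemma pathLen_update_zero_le (x : ℕ → EuclideanSpace ℝ (Fin m)) (s : ℕ)
    (y : EuclideanSpace ℝ (Fin m)) :
    pathLen (Function.update x 0 y) s ≤ pathLen x s + dist y (x 0) := by
  rcases s with _ | s
  · simp [pathLen]
  · linarith [pathLen_update_zero x s y, dist_triangle y (x 0) (x 1)]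

/-- A shortest path for the concatenation is cut at the junction, and its second part is translated
back to the origin. -/
lemma SmallBody.minLen_add_le (hO : SmallBody O z r) (w w' : List (Fin m → ℤ)) :
    minLen O w + minLen O w' ≤ minLen O (w ++ w') := by
  obtain ⟨x, hx, hlen⟩ := hO.exists_pathLen_eq_minLen (w ++ w')
  rw [← hlen, List.length_append, pathLen_add]
  -- `IsPath` constrains every index, and positions are constant past the end of the word, so the
  -- path is frozen there.
  have h1 : IsPath O w fun i => x (min i w.length) := by
    intro i
    have := hx (min i w.length)
    rw [vertex_append_of_le _ _ (min_le_right _ _)] at this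
    rcases le_total i w.length with h | h
    · simpa [min_eq_left h] using this
    · simpa [min_eq_right h, vertex_of_length_le h, vertex_of_length_le le_rfl] using this
  have h2 : IsPath O w' fun i => x (w.length + i) - intVec w.sum := by
    intro i
    have := hx (w.length + i)
    rw [vertex_append_add, mem_lift_iff, intVec_add] at this
    rw [mem_lift_iff]
    rwa [sub_sub]
  have h3 := minLen_le h1
  have h4 := minLen_le h2
  rw [pathLen_congr (y := x) (fun i hi => by simp [hi])] at h3
  have h5 : pathLen (fun i => x (w.length + i) - intVec w.sum) w'.length =
      pathLen (fun i => x (w.length + i)) w'.length := by simp [pathLen]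
  linarith

/-- Two shortest paths are glued. The end of the first and the translated start of the second lie in
the same obstacle, so the repair costs at most `2 * r`. -/
lemma SmallBody.minLen_append_le (hO : SmallBody O z r) (w w' : List (Fin m → ℤ)) :
    minLen O (w ++ w') ≤ minLen O w + minLen O w' + 2 * r := by
  obtain ⟨y, hy, hlen⟩ := hO.exists_pathLen_eq_minLen w
  obtain ⟨y', hy', hlen'⟩ := hO.exists_pathLen_eq_minLen w'
  rw [← hlen, ← hlen']
  set x : ℕ → EuclideanSpace ℝ (Fin m) := fun i =>
    if i ≤ w.length then y i else y' (i - w.length) + intVec w.sum with hxdef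
  have hshift : ∀ i, y' i + intVec w.sum ∈ lift O (w.sum + vertex w' i) := by
    intro i
    have := mem_lift_iff.1 (hy' i)
    rw [mem_lift_iff, intVec_add]
    convert this using 1
    abel
  have hx : IsPath O (w ++ w') x := by
    intro i
    by_cases h : i ≤ w.length
    · simpa [hxdef, h, vertex_append_of_le _ _ h] using hy i
    · obtain ⟨n, rfl⟩ := Nat.exists_eq_add_of_le (not_le.1 h).le
      simpa [hxdef, h, vertex_append_add] using hshift n
  refine (minLen_le hx).trans ?_
  rw [List.length_append, pathLen_add]
  have e1 : pathLen x w.length = pathLen y w.length :=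
    pathLen_congr fun i hi => by simp [hxdef, hi]
  have e2 : (fun i => x (w.length + i)) =
      Function.update (fun i => y' i + intVec w.sum) 0 (y w.length) := by
    ext1 i
    rcases i with _ | i
    · simp [hxdef]
    · simp [hxdef]
  have e3 : pathLen (fun i => y' i + intVec w.sum) w'.length = pathLen y' w'.length := by
    simp [pathLen]
  have h1 := pathLen_update_zero_le (fun i => y' i + intVec w.sum) w'.length (y w.length)
  have h2 := hy w.length
  have h3 := hshift 0
  rw [vertex_of_length_le le_rfl] at h2
  rw [vertex_zero, add_zero] at h3
  have h4 := hO.norm_sub_sub_le h2 h3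
  rw [sub_self, intVec_zero, sub_zero, ← dist_eq_norm] at h4
  rw [e1, e2]
  linarith

lemma SmallBody.minLen_le_sum_norm (hO : SmallBody O z r) (w : List (Fin m → ℤ)) :
    minLen O w ≤ (w.map fun l => ‖intVec l‖).sum := by
  obtain ⟨p, hp⟩ := hO.nonempty
  refine (minLen_le (x := fun i => p + intVec (vertex w i)) fun i => ⟨p, hp, rfl⟩).trans
    (le_of_eq ?_)
  induction w with
  | nil => simp [pathLen]
  | cons l w ih =>
    rw [List.length_cons, pathLen, sum_range_succ', List.map_cons, List.sum_cons, ← ih, pathLen,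
      add_comm]
    congr 1
    · simp [vertex_cons_succ, vertex_zero]
    · simp [vertex_cons_succ, intVec_add]

lemma SmallBody.norm_intVec_sum_le (hO : SmallBody O z r) (w : List (Fin m → ℤ)) :
    ‖intVec w.sum‖ ≤ minLen O w + 2 * r := by
  obtain ⟨x, hx, hlen⟩ := hO.exists_pathLen_eq_minLen w
  have h1 := hx w.length
  rw [vertex_of_length_le le_rfl] at h1
  have h2 := hx 0
  rw [vertex_zero] at h2
  have h3 := hO.norm_sub_sub_le h1 h2
  rw [sub_zero] at h3
  have h4 := dist_le_range_sum_dist x w.length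
  rw [dist_comm, dist_eq_norm] at h4
  change _ ≤ pathLen x w.length at h4
  have h5 := norm_sub_norm_le (intVec w.sum) (x w.length - x 0)
  rw [norm_sub_rev (intVec w.sum)] at h5
  linarith

/-- A shortest path along a valid word is an admissible trajectory piece. -/
lemma SmallBody.exists_admissiblePiece (hO : SmallBody O z r) {w : List (Fin m → ℤ)}
    (hw : Valid O w) (hne : w ≠ []) :
    ∃ a b, HasAdmissiblePiece O a b (minLen O w) ∧ ‖(b - a) - intVec w.sum‖ ≤ 2 * r := by
  obtain ⟨x, hx, hlen⟩ := hO.exists_pathLen_eq_minLen w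
  have hadm := hw.isAdmissible hO
  refine ⟨x 0, x w.length, ⟨w.length, vertex w, x, hadm, ?_, rfl, rfl, hlen⟩, ?_⟩
  · exact isTrajectoryPiece_of_min hO.convex (List.length_pos_iff.2 hne) hadm
      (fun _ _ => hO.disjoint_lift) hx fun y hy => hlen.le.trans (minLen_le hy)
  · have h1 := hx w.length
    rw [vertex_of_length_le le_rfl] at h1
    have h2 := hx 0
    rw [vertex_zero] at h2
    simpa using hO.norm_sub_sub_le h1 h2

end

section

open Finset

variable {m : ℕ}

/-! ### The admissible rotation set -/

lemma mem_admissibleRotationSet_iff {O : Set (EuclideanSpace ℝ (Fin m))}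
    {u : EuclideanSpace ℝ (Fin m)} :
    u ∈ admissibleRotationSet O ↔ ∀ ε : ℝ, 0 < ε → ∀ T : ℝ, ∃ a b t, HasAdmissiblePiece O a b t ∧
      T ≤ t ∧ ‖t⁻¹ • (b - a) - u‖ ≤ ε := by
  constructor
  · rintro ⟨a, b, t, h, ht, hu⟩ ε hε T
    have h1 := Metric.tendsto_nhds.1 hu ε hε
    obtain ⟨n, hn1, hn2⟩ := (h1.and (ht.eventually_ge_atTop T)).exists
    rw [dist_eq_norm] at hn1
    exact ⟨a n, b n, t n, h n, hn2, hn1.le⟩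
  · intro h
    choose a b t h1 h2 h3 using fun n : ℕ => h (1 / ((n : ℝ) + 1)) (by positivity) n
    refine ⟨a, b, t, h1, Filter.tendsto_atTop_mono h2 tendsto_natCast_atTop_atTop, ?_⟩
    rw [tendsto_iff_norm_sub_tendsto_zero]
    exact squeeze_zero (fun _ => norm_nonneg _) h3 tendsto_one_div_add_atTop_nhds_zero_nat

lemma isClosed_admissibleRotationSet (O : Set (EuclideanSpace ℝ (Fin m))) :
    IsClosed (admissibleRotationSet O) := by
  refine isClosed_of_closure_subset fun u hu => ?_
  rw [mem_admissibleRotationSet_iff]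
  intro ε hε T
  obtain ⟨v, hv, huv⟩ := Metric.mem_closure_iff.1 hu (ε / 2) (by positivity)
  obtain ⟨a, b, t, h1, h2, h3⟩ := mem_admissibleRotationSet_iff.1 hv (ε / 2) (by positivity) T
  refine ⟨a, b, t, h1, h2, ?_⟩
  rw [dist_comm, dist_eq_norm] at huv
  have := norm_sub_le_norm_sub_add_norm_sub (t⁻¹ • (b - a)) v u
  linarith

lemma norm_le_one_of_mem_admissibleRotationSet {O : Set (EuclideanSpace ℝ (Fin m))}
    {u : EuclideanSpace ℝ (Fin m)} (hu : u ∈ admissibleRotationSet O) : ‖u‖ ≤ 1 := by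
  refine le_of_forall_pos_le_add fun ε hε => ?_
  obtain ⟨a, b, t, ⟨s, k, x, -, -, rfl, rfl, h2⟩, h3, h4⟩ :=
    mem_admissibleRotationSet_iff.1 hu ε hε 1
  have ht : 0 < t := by linarith
  have h5 := dist_le_range_sum_dist x s
  rw [h2, dist_comm, dist_eq_norm] at h5
  have h6 : ‖t⁻¹ • (x s - x 0)‖ ≤ 1 := by
    rw [norm_smul, norm_inv, Real.norm_of_nonneg ht.le, inv_mul_le_iff₀ ht]
    linarith
  have := norm_sub_norm_le u (t⁻¹ • (x s - x 0))
  rw [norm_sub_rev] at this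
  linarith

/-! ### The cone of asymptotic displacements and lengths -/

/-- Valid words that begin with the step `c` and end with the step `-c`. -/
structure IsLoop (O : Set (EuclideanSpace ℝ (Fin m))) (c : Fin m → ℤ)
    (w : List (Fin m → ℤ)) : Prop where
  valid : Valid O w
  head : w.head? = some c
  last : w.getLast? = some (-c)

lemma IsLoop.append {O : Set (EuclideanSpace ℝ (Fin m))} {c : Fin m → ℤ}
    {w w' : List (Fin m → ℤ)} (h : IsLoop O c w) (h' : IsLoop O c w') : IsLoop O c (w ++ w') := by
  refine ⟨h.valid.append h'.valid ?_, ?_, ?_⟩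
  · simp only [h.last, h'.head, Option.mem_some_iff, forall_eq', neg_dotProduct]
    have := dotProduct_self_nonneg c
    omega
  · rw [List.head?_append, h.head, Option.some_or]
  · rw [List.getLast?_append, h'.last, Option.some_or]

/-- The pairs `(d, t)` such that for all large `a` there is a loop word with displacement close to
`a d` and minimal path length close to `a t`, up to an error `o(a)`. -/
def asymptoticCone (O : Set (EuclideanSpace ℝ (Fin m))) (c : Fin m → ℤ) :
    Set (EuclideanSpace ℝ (Fin m) × ℝ) :=
  {p | ∀ ε : ℝ, 0 < ε → ∃ A : ℝ, ∀ a : ℝ, A ≤ a → ∃ w, IsLoop O c w ∧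
    ‖intVec w.sum - a • p.1‖ ≤ ε * a ∧ |minLen O w - a * p.2| ≤ ε * a}

section Cone

variable {O : Set (EuclideanSpace ℝ (Fin m))} {z : EuclideanSpace ℝ (Fin m)} {r : ℝ}
  {c : Fin m → ℤ}

lemma SmallBody.free_unit (hO : SmallBody O z r) (hc : c ⬝ᵥ c = 1) : Free O c ∧ Free O (-c) :=
  ⟨hO.free_of_dotProduct_self_eq_one hc, hO.free_of_dotProduct_self_eq_one (by simpa using hc)⟩

lemma SmallBody.zero_mem_cone (hO : SmallBody O z r) (hc : c ⬝ᵥ c = 1) :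
    (0 : EuclideanSpace ℝ (Fin m) × ℝ) ∈ asymptoticCone O c := by
  intro ε hε
  -- The empty word is no loop, so a fixed short loop represents zero; its length is negligible
  -- against `ε * a`.
  have hloop : IsLoop O c [c, -c] := by
    refine ⟨⟨?_, ?_⟩, rfl, rfl⟩
    · simp [hO.free_unit hc]
    · simp [hc]
  refine ⟨minLen O [c, -c] / ε, fun a ha => ⟨_, hloop, ?_, ?_⟩⟩
  · have h0 : 0 ≤ minLen O [c, -c] / ε := div_nonneg (minLen_nonneg _) hε.le
    simp
    nlinarith
  · rw [div_le_iff₀ hε] at ha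
    simp only [Prod.snd_zero, mul_zero, sub_zero, abs_of_nonneg (minLen_nonneg _)]
    linarith

lemma SmallBody.add_mem_cone (hO : SmallBody O z r) {p q : EuclideanSpace ℝ (Fin m) × ℝ}
    (hp : p ∈ asymptoticCone O c) (hq : q ∈ asymptoticCone O c) :
    p + q ∈ asymptoticCone O c := by
  intro ε hε
  obtain ⟨A, hA⟩ := hp (ε / 3) (by positivity)
  obtain ⟨B, hB⟩ := hq (ε / 3) (by positivity)
  refine ⟨max (max A B) (2 * r / (ε / 3)), fun a ha => ?_⟩
  obtain ⟨w, h1, h2, h3⟩ := hA a ((le_max_left _ _).trans ((le_max_left _ _).trans ha))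
  obtain ⟨w', h1', h2', h3'⟩ := hB a ((le_max_right _ _).trans ((le_max_left _ _).trans ha))
  have h4 := (le_max_right _ _).trans ha
  rw [div_le_iff₀ (by positivity)] at h4
  have hr := hO.radius_nonneg
  refine ⟨_, h1.append h1', ?_, ?_⟩
  · have e : intVec (w ++ w').sum - a • (p + q).1 =
        (intVec w.sum - a • p.1) + (intVec w'.sum - a • q.1) := by
      rw [List.sum_append, intVec_add, Prod.fst_add, smul_add]; abel
    rw [e]
    refine (norm_add_le _ _).trans ?_
    linarith
  · have h5 := hO.minLen_add_le w w'
    have h6 := hO.minLen_append_le w w'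
    rw [abs_le] at h3 h3' ⊢
    rw [Prod.snd_add, mul_add]
    constructor <;> linarith [h3.1, h3.2, h3'.1, h3'.2]

lemma SmallBody.smul_mem_cone (hO : SmallBody O z r) (hc : c ⬝ᵥ c = 1)
    {p : EuclideanSpace ℝ (Fin m) × ℝ} (hp : p ∈ asymptoticCone O c) {b : ℝ} (hb : 0 ≤ b) :
    b • p ∈ asymptoticCone O c := by
  rcases hb.eq_or_lt with rfl | hb
  · rw [zero_smul]; exact hO.zero_mem_cone hc
  intro ε hε
  obtain ⟨A, hA⟩ := hp (ε / b) (by positivity)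
  refine ⟨A / b, fun a ha => ?_⟩
  rw [div_le_iff₀ hb] at ha
  obtain ⟨w, h1, h2, h3⟩ := hA (a * b) ha
  have e : ε / b * (a * b) = ε * a := by field_simp
  rw [e] at h2 h3
  exact ⟨w, h1, by simpa [smul_smul] using h2, by simpa [mul_assoc] using h3⟩

lemma isClosed_cone : IsClosed (asymptoticCone O c) := by
  refine isClosed_of_closure_subset fun p hp ε hε => ?_
  obtain ⟨q, hq, hpq⟩ := Metric.mem_closure_iff.1 hp (ε / 2) (by positivity)
  obtain ⟨A, hA⟩ := hq (ε / 2) (by positivity)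
  refine ⟨max A 0, fun a ha => ?_⟩
  obtain ⟨w, h1, h2, h3⟩ := hA a ((le_max_left _ _).trans ha)
  have ha0 : 0 ≤ a := (le_max_right _ _).trans ha
  rw [dist_comm, dist_eq_norm] at hpq
  refine ⟨w, h1, ?_, ?_⟩
  · have e : intVec w.sum - a • p.1 = (intVec w.sum - a • q.1) + a • (q - p).1 := by
      rw [Prod.fst_sub, smul_sub]; abel
    rw [e]
    refine (norm_add_le _ _).trans ?_
    rw [norm_smul, Real.norm_of_nonneg ha0]
    nlinarith [norm_fst_le (q - p)]
  · have e : minLen O w - a * p.2 = (minLen O w - a * q.2) + a * (q - p).2 := by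
      rw [Prod.snd_sub]; ring
    rw [e]
    refine (abs_add_le _ _).trans ?_
    rw [abs_mul, abs_of_nonneg ha0]
    have := norm_snd_le (q - p)
    rw [Real.norm_eq_abs] at this
    nlinarith

/-- A path is at least as long as its displacement, and the end effects of size `2 * r` vanish in
the limit. This later bounds speeds by 1 and makes the lengths positive, so that dividing by them is
legitimate. -/
lemma SmallBody.norm_fst_le_of_mem_cone (hO : SmallBody O z r)
    {p : EuclideanSpace ℝ (Fin m) × ℝ} (hp : p ∈ asymptoticCone O c) : ‖p.1‖ ≤ p.2 := by
  refine le_of_forall_pos_le_add fun ε hε => ?_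
  obtain ⟨A, hA⟩ := hp (ε / 3) (by positivity)
  have h4 := (le_max_left (max A 1) (2 * r / (ε / 3)))
  have h5 := (le_max_right (max A 1) (2 * r / (ε / 3)))
  obtain ⟨w, -, h2, h3⟩ := hA _ ((le_max_left _ _).trans h4)
  have ha : 0 < max (max A 1) (2 * r / (ε / 3)) :=
    zero_lt_one.trans_le ((le_max_right _ _).trans h4)
  generalize max (max A 1) (2 * r / (ε / 3)) = a at *
  rw [div_le_iff₀ (by positivity)] at h5
  have h6 := hO.norm_intVec_sum_le w
  have h7 := norm_sub_norm_le (a • p.1) (intVec w.sum)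
  rw [norm_sub_rev, norm_smul, Real.norm_of_nonneg ha.le] at h7
  have h8 := (abs_le.1 h3).2
  have : a * ‖p.1‖ ≤ a * (p.2 + ε) := by linarith
  exact le_of_mul_le_mul_left this ha

/-- A loop word at a large scale `a` is realised by its shortest path, whose displacement and length
are close to `a • u` and `a`. -/
lemma SmallBody.mem_admissibleRotationSet (hO : SmallBody O z r) {u : EuclideanSpace ℝ (Fin m)}
    (hu : (u, (1 : ℝ)) ∈ asymptoticCone O c) : u ∈ admissibleRotationSet O := by
  rw [mem_admissibleRotationSet_iff]
  intro ε hε T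
  have hr := hO.radius_nonneg
  -- The half ensures that the length is at least `a / 2`. The error has three parts, bounded by `2
  -- * r ≤ δ * a`, `δ * a` and `δ * a * ‖u‖`, which accounts for the factor `2 + ‖u‖`.
  set δ : ℝ := min (1 / 2) (ε / (2 * (2 + ‖u‖))) with hδ
  have hδ0 : 0 < δ := by positivity
  have hδ1 : δ ≤ 1 / 2 := min_le_left _ _
  have hδ2 : δ * (2 * (2 + ‖u‖)) ≤ ε := by
    rw [← le_div_iff₀ (by positivity)]; exact min_le_right _ _
  obtain ⟨A, hA⟩ := hu δ hδ0
  obtain ⟨a, ha⟩ : ∃ a, max (max A 1) (max (2 * T) (2 * r / δ)) ≤ a := ⟨_, le_rfl⟩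
  simp only [max_le_iff] at ha
  obtain ⟨⟨ha1, ha2⟩, ha3, ha4⟩ := ha
  rw [div_le_iff₀ hδ0] at ha4
  obtain ⟨w, h1, h2, h3⟩ := hA a ha1
  simp only [mul_one] at h2 h3
  have hne : w ≠ [] := by
    rintro rfl
    simpa using h1.head
  obtain ⟨x, y, hp, hxy⟩ := hO.exists_admissiblePiece h1.valid hne
  have h4 := abs_le.1 h3
  have h5 : a / 2 ≤ minLen O w := by nlinarith [h4.1]
  refine ⟨x, y, _, hp, by linarith, ?_⟩
  generalize minLen O w = t at *
  have ht : 0 < t := by linarith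
  have e : t⁻¹ • (y - x) - u = t⁻¹ • ((y - x) - intVec w.sum + (intVec w.sum - a • u) -
      (t - a) • u) := by
    rw [sub_smul, ← smul_right_injective _ ht.ne' |>.eq_iff]
    simp only [smul_sub, smul_add, smul_smul, mul_inv_cancel₀ ht.ne', one_smul]
    simp only [← mul_assoc, mul_inv_cancel₀ ht.ne', one_mul]
    abel
  rw [e, norm_smul, norm_inv, Real.norm_of_nonneg ht.le, inv_mul_le_iff₀ ht]
  have h6 := norm_sub_le ((y - x) - intVec w.sum + (intVec w.sum - a • u)) ((t - a) • u)
  have h7 := norm_add_le ((y - x) - intVec w.sum) (intVec w.sum - a • u)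
  rw [norm_smul, Real.norm_eq_abs] at h6
  have h8 := mul_le_mul_of_nonneg_right h3 (norm_nonneg u)
  have h9 : δ * a * (2 + ‖u‖) ≤ t * ε := by nlinarith [norm_nonneg u]
  linarith

lemma SmallBody.convex_slice (hO : SmallBody O z r) (hc : c ⬝ᵥ c = 1) :
    Convex ℝ {u : EuclideanSpace ℝ (Fin m) | (u, (1 : ℝ)) ∈ asymptoticCone O c} := by
  intro u hu v hv a b ha hb hab
  have := hO.add_mem_cone (hO.smul_mem_cone hc hu ha) (hO.smul_mem_cone hc hv hb)
  simpa [hab] using this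

lemma isClosed_slice :
    IsClosed {u : EuclideanSpace ℝ (Fin m) | (u, (1 : ℝ)) ∈ asymptoticCone O c} :=
  isClosed_cone.preimage (by fun_prop : Continuous fun u => (u, (1 : ℝ)))

lemma SmallBody.slice_mem (hO : SmallBody O z r) (hc : c ⬝ᵥ c = 1)
    {d : EuclideanSpace ℝ (Fin m)} {t : ℝ} (ht : 0 < t) (h : (d, t) ∈ asymptoticCone O c) :
    (t⁻¹ • d, (1 : ℝ)) ∈ asymptoticCone O c := by
  have := hO.smul_mem_cone hc h (inv_pos.2 ht).le
  simpa [ht.ne'] using this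

/-- A ball lies in the admissible rotation set if the asymptotic cone has the right support
function. -/
lemma SmallBody.closedBall_subset (hO : SmallBody O z r) (hc : c ⬝ᵥ c = 1) {ρ : ℝ}
    (h : ∀ u : EuclideanSpace ℝ (Fin m), ‖u‖ = 1 → ∀ δ : ℝ, 0 < δ →
      ∃ v, (v, (1 : ℝ)) ∈ asymptoticCone O c ∧ ρ - δ ≤ inner ℝ v u) :
    Metric.closedBall 0 ρ ⊆ admissibleRotationSet O := by
  intro v hv
  refine hO.mem_admissibleRotationSet (c := c) ?_
  by_contra hn
  obtain ⟨f, s, hf1, hf2⟩ := geometric_hahn_banach_closed_point (hO.convex_slice hc)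
    isClosed_slice hn
  set a := (InnerProductSpace.toDual ℝ (EuclideanSpace ℝ (Fin m))).symm f with ha
  have hfa : ∀ x, f x = inner ℝ x a := fun x => by
    rw [real_inner_comm, ha, InnerProductSpace.toDual_symm_apply]
  have hv' : ‖v‖ ≤ ρ := by simpa using hv
  -- A vanishing functional could not separate, because the hypothesis makes the slice nonempty.
  have ha0 : 0 < ‖a‖ := by
    rw [norm_pos_iff]
    intro h0
    have hf0 : ∀ x, f x = 0 := fun x => by rw [hfa, h0, inner_zero_right]
    obtain ⟨u, hu⟩ : ∃ u : EuclideanSpace ℝ (Fin m), ‖u‖ = 1 := ⟨intVec c, norm_intVec_of_unit hc⟩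
    obtain ⟨w, hw, -⟩ := h u hu 1 one_pos
    have := hf1 w hw
    rw [hf0] at this hf2
    linarith
  have hpos : 0 < (f v - s) / ‖a‖ := div_pos (sub_pos.2 hf2) ha0
  obtain ⟨w, hw, hwu⟩ := h (‖a‖⁻¹ • a) (by rw [norm_smul, norm_inv, norm_norm,
    inv_mul_cancel₀ ha0.ne']) _ hpos
  have h1 := hf1 w hw
  rw [real_inner_smul_right, ← hfa, ← div_eq_inv_mul, le_div_iff₀ ha0, sub_mul,
    div_mul_cancel₀ _ ha0.ne'] at hwu
  have h2 : f v ≤ ‖v‖ * ‖a‖ := by rw [hfa]; exact real_inner_le_norm _ _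
  nlinarith

end Cone

end

section

open Finset

variable {m : ℕ}

/-! ### Periodic words -/

section Periodic

variable {O : Set (EuclideanSpace ℝ (Fin m))} {z : EuclideanSpace ℝ (Fin m)} {r : ℝ}
  {c l e : Fin m → ℤ}

/-- The word `l, e, l, e, …` with `n` periods. -/
def alternating (l e : Fin m → ℤ) : ℕ → List (Fin m → ℤ)
  | 0 => []
  | n + 1 => [l, e] ++ alternating l e n

lemma alternating_add (l e : Fin m → ℤ) (a b : ℕ) :
    alternating l e (a + b) = alternating l e a ++ alternating l e b := by
  induction a with
  | zero => simp [alternating]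
  | succ a ih => rw [Nat.add_right_comm, alternating, alternating, ih, List.append_assoc]

lemma alternating_succ_eq_append (l e : Fin m → ℤ) (n : ℕ) :
    alternating l e (n + 1) = alternating l e n ++ [l, e] := by
  rw [alternating_add]; rfl

lemma sum_alternating (l e : Fin m → ℤ) (n : ℕ) :
    (alternating l e n).sum = n • (l + e) := by
  induction n with
  | zero => simp [alternating]
  | succ n ih => rw [alternating, List.sum_append, ih, add_comm n, add_nsmul, one_nsmul]; simp

lemma sum_norm_alternating (l e : Fin m → ℤ) (n : ℕ) :
    ((alternating l e n).map fun l => ‖intVec l‖).sum = n * (‖intVec l‖ + ‖intVec e‖) := by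
  induction n with
  | zero => simp [alternating]
  | succ n ih => rw [alternating, List.map_append, List.sum_append, ih]; push_cast; simp; ring

lemma valid_alternating (hl : Free O l) (he : Free O e) (hle : l ⬝ᵥ e ≤ 0) (n : ℕ) :
    Valid O (alternating l e n) := by
  induction n with
  | zero => exact ⟨by simp [alternating], by simp [alternating]⟩
  | succ n ih =>
    refine Valid.append ⟨by simp [hl, he], by simpa using hle⟩ ih ?_
    rcases n with _ | n
    · simp [alternating]
    · simpa [alternating, dotProduct_comm] using hle

/-- There is a valid word from the step `c` to a step after which `l` may follow. -/
lemma SmallBody.exists_prefix (hO : SmallBody O z r) (hc : c ⬝ᵥ c = 1) (l : Fin m → ℤ) :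
    ∃ w, Valid O w ∧ w.head? = some c ∧ ∀ x ∈ w.getLast?, x ⬝ᵥ l ≤ 0 := by
  rcases le_total (c ⬝ᵥ l) 0 with h | h
  · exact ⟨[c], ⟨by simp [hO.free_unit hc], by simp⟩, rfl, by simpa using h⟩
  · exact ⟨[c, -c], ⟨by simp [hO.free_unit hc], by simp [hc]⟩, rfl, by simpa using h⟩

/-- There is a valid word to the step `-c` that may follow the step `e`. -/
lemma SmallBody.exists_suffix (hO : SmallBody O z r) (hc : c ⬝ᵥ c = 1) (e : Fin m → ℤ) :
    ∃ w, Valid O w ∧ w.getLast? = some (-c) ∧ ∀ x ∈ w.head?, e ⬝ᵥ x ≤ 0 := by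
  rcases le_total 0 (e ⬝ᵥ c) with h | h
  · exact ⟨[-c], ⟨by simp [hO.free_unit hc], by simp⟩, rfl, by simpa using h⟩
  · exact ⟨[c, -c], ⟨by simp [hO.free_unit hc], by simp [hc]⟩, rfl, by simpa using h⟩

/-- A prefix and a suffix independent of `n` turn the periodic word into a loop, changing
displacement and length only by bounded amounts. The two gluings account for `4 * r`. -/
lemma SmallBody.exists_loop_alternating (hO : SmallBody O z r) (hc : c ⬝ᵥ c = 1) (hl : Free O l)
    (he : Free O e) (hle : l ⬝ᵥ e ≤ 0) :
    ∃ (v : Fin m → ℤ) (C : ℝ), ∀ n : ℕ, 0 < n → ∃ w, IsLoop O c w ∧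
      w.sum = n • (l + e) + v ∧ |minLen O w - minLen O (alternating l e n)| ≤ C := by
  obtain ⟨p, hp1, hp2, hp3⟩ := hO.exists_prefix hc l
  obtain ⟨q, hq1, hq2, hq3⟩ := hO.exists_suffix hc e
  refine ⟨p.sum + q.sum, minLen O p + minLen O q + 4 * r, fun n hn => ?_⟩
  obtain ⟨n, rfl⟩ := Nat.exists_eq_succ_of_ne_zero hn.ne'
  refine ⟨p ++ (alternating l e (n + 1) ++ q), ⟨hp1.append
    ((valid_alternating hl he hle _).append hq1 ?_) ?_, ?_, ?_⟩, ?_, ?_⟩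
  · rw [alternating_succ_eq_append]
    simpa using hq3
  · simpa [alternating] using hp3
  · rw [List.head?_append, hp2, Option.some_or]
  · rw [List.getLast?_append, List.getLast?_append, hq2, Option.some_or, Option.some_or]
  · rw [List.sum_append, List.sum_append, sum_alternating]
    abel
  · have h1 := hO.minLen_add_le p (alternating l e (n + 1) ++ q)
    have h2 := hO.minLen_append_le p (alternating l e (n + 1) ++ q)
    have h3 := hO.minLen_add_le (alternating l e (n + 1)) q
    have h4 := hO.minLen_append_le (alternating l e (n + 1)) q
    have h5 := minLen_nonneg (O := O) p
    have h6 := minLen_nonneg (O := O) q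
    have h7 := hO.radius_nonneg
    rw [abs_le]
    constructor <;> linarith

/-- The average minimal length of a period of the word `l, e, l, e, …`. -/
lemma SmallBody.tendsto_minLen_alternating (hO : SmallBody O z r) (l e : Fin m → ℤ) :
    ∃ τ : ℝ, 0 ≤ τ ∧ τ ≤ ‖intVec l‖ + ‖intVec e‖ ∧
      Filter.Tendsto (fun n : ℕ => minLen O (alternating l e n) / n) Filter.atTop (nhds τ) := by
  have hub : ∀ n : ℕ, minLen O (alternating l e n) / n ≤ ‖intVec l‖ + ‖intVec e‖ := by
    intro n
    rcases n.eq_zero_or_pos with rfl | hn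
    · simp; positivity
    · rw [div_le_iff₀ (by exact_mod_cast hn), mul_comm, ← sum_norm_alternating]
      exact hO.minLen_le_sum_norm _
  -- Minimal lengths are superadditive, so Fekete's lemma is applied to their negatives.
  have hsub : Subadditive fun n : ℕ => -minLen O (alternating l e n) := by
    intro a b
    simp only [alternating_add]
    linarith [hO.minLen_add_le (alternating l e a) (alternating l e b)]
  have h1 := hsub.tendsto_lim ⟨-(‖intVec l‖ + ‖intVec e‖), by
    rintro _ ⟨n, rfl⟩
    simp only [neg_div]
    exact neg_le_neg (hub n)⟩
  have h2 := h1.neg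
  simp only [neg_div, neg_neg] at h2
  exact ⟨_, ge_of_tendsto' h2 fun n => div_nonneg (minLen_nonneg _) n.cast_nonneg,
    le_of_tendsto' h2 hub, h2⟩

/-- At scale `a` the loop with `⌊a⌋₊` periods is used, and `τ` is the limiting length per period;
rounding and the ends cost `O(1)`, and the convergence to `τ` costs `o(a)`. -/
lemma SmallBody.alternating_mem_cone (hO : SmallBody O z r) (hc : c ⬝ᵥ c = 1) (hl : Free O l)
    (he : Free O e) (hle : l ⬝ᵥ e ≤ 0) :
    ∃ τ : ℝ, τ ≤ ‖intVec l‖ + ‖intVec e‖ ∧ (intVec (l + e), τ) ∈ asymptoticCone O c := by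
  obtain ⟨τ, hτ0, hτ1, hτ⟩ := hO.tendsto_minLen_alternating l e
  obtain ⟨v, C, hv⟩ := hO.exists_loop_alternating hc hl he hle
  refine ⟨τ, hτ1, fun ε hε => ?_⟩
  obtain ⟨n₀, hn₀⟩ := Filter.eventually_atTop.1 (Metric.tendsto_nhds.1 hτ (ε / 2) (by positivity))
  refine ⟨max (max (n₀ + 1) 1) (max ((‖intVec v‖ + ‖intVec (l + e)‖) / ε) ((C + τ) / (ε / 2))),
    fun a ha => ?_⟩
  simp only [max_le_iff] at ha
  obtain ⟨⟨ha1, ha2⟩, ha3, ha4⟩ := ha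
  rw [div_le_iff₀ hε] at ha3
  rw [div_le_iff₀ (by positivity)] at ha4
  have ha0 : 0 ≤ a := by linarith
  have hn1 : (⌊a⌋₊ : ℝ) ≤ a := Nat.floor_le ha0
  have hn2 : a < ⌊a⌋₊ + 1 := Nat.lt_floor_add_one a
  have hn3 : n₀ ≤ ⌊a⌋₊ := Nat.le_floor (by linarith)
  have hn4 : 0 < ⌊a⌋₊ := Nat.floor_pos.2 ha2
  generalize ⌊a⌋₊ = n at *
  obtain ⟨w, h1, h2, h3⟩ := hv n hn4
  refine ⟨w, h1, ?_, ?_⟩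
  · have e1 : intVec w.sum - a • intVec (l + e) = intVec v - (a - n) • intVec (l + e) := by
      rw [h2, intVec_add, ← natCast_zsmul, intVec_zsmul, sub_smul, Int.cast_natCast]
      abel
    dsimp only
    rw [e1]
    refine (norm_sub_le _ _).trans ?_
    rw [norm_smul, Real.norm_of_nonneg (by linarith)]
    nlinarith [norm_nonneg (intVec (l + e))]
  · have h4 := hn₀ n hn3
    have hn5 : (0 : ℝ) < n := by exact_mod_cast hn4
    rw [Real.dist_eq, ← mul_lt_mul_iff_of_pos_right hn5, ← abs_of_pos hn5, ← abs_mul,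
      abs_of_pos hn5, sub_mul, div_mul_cancel₀ _ hn5.ne'] at h4
    have h5 : |minLen O w - a * τ| ≤ |minLen O w - minLen O (alternating l e n)| +
        |minLen O (alternating l e n) - τ * n| + |(a - n) * τ| := by
      have e2 : minLen O w - a * τ = (minLen O w - minLen O (alternating l e n)) +
        (minLen O (alternating l e n) - τ * n) - (a - n) * τ := by ring
      rw [e2]
      exact (abs_sub _ _).trans (add_le_add_left (abs_add_le _ _) _)
    rw [abs_of_nonneg (mul_nonneg (by linarith) hτ0)] at h5
    dsimp only
    nlinarith

end Periodic

end

section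

open Finset

variable {m : ℕ}

/-! ### Points of the slice in the direction of a free vector -/

section Free

variable {O : Set (EuclideanSpace ℝ (Fin m))} {z : EuclideanSpace ℝ (Fin m)} {r : ℝ}
  {c l : Fin m → ℤ}

lemma exists_eq_zero_of_unit (hm : 2 ≤ m) (hl : l ⬝ᵥ l = 1) : ∃ j, l j = 0 := by
  by_contra! h
  have h1 : ∑ _i : Fin m, (1 : ℤ) ≤ l ⬝ᵥ l :=
    sum_le_sum fun i _ => by
      have := mul_self_pos.2 (h i)
      omega
  simp at h1
  omega

/-- The words alternating `l` with `e_j` and with `-e_j`, for a coordinate `j` where `l` vanishes,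
have total displacement `2 • l` and total length at most 4. -/
lemma SmallBody.unit_mem_slice (hO : SmallBody O z r) (hc : c ⬝ᵥ c = 1) (hm : 2 ≤ m)
    (hl : l ⬝ᵥ l = 1) :
    ∃ s : ℝ, 1 / 2 ≤ s ∧ s ≤ 1 ∧ (s • ‖intVec l‖⁻¹ • intVec l, (1 : ℝ)) ∈ asymptoticCone O c := by
  obtain ⟨j, hj⟩ := exists_eq_zero_of_unit hm hl
  have he : (Pi.single j 1 : Fin m → ℤ) ⬝ᵥ Pi.single j 1 = 1 := by simp
  have hle : l ⬝ᵥ Pi.single j 1 = 0 := by simp [hj]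
  have hL := norm_intVec_of_unit hl
  have hE := norm_intVec_of_unit he
  obtain ⟨τ, h1, h2⟩ := hO.alternating_mem_cone hc (hO.free_unit hl).1 (hO.free_unit he).1 hle.le
  obtain ⟨τ', h1', h2'⟩ := hO.alternating_mem_cone hc (hO.free_unit hl).1 (hO.free_unit he).2
    (by rw [dotProduct_neg, hle, neg_zero])
  have h3 := hO.add_mem_cone h2 h2'
  have e : (intVec (l + Pi.single j 1), τ) + (intVec (l + -Pi.single j 1), τ') =
      ((2 : ℝ) • intVec l, τ + τ') := by
    rw [Prod.mk_add_mk, ← intVec_add, two_smul, ← intVec_add]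
    congr 2
    abel
  rw [e] at h3
  have h4 := hO.norm_fst_le_of_mem_cone h3
  rw [norm_smul, hL] at h4
  norm_num at h4
  rw [intVec_neg, norm_neg] at h1'
  have hpos : 0 < τ + τ' := by linarith
  refine ⟨2 / (τ + τ'), ?_, ?_, ?_⟩
  · rw [div_le_div_iff₀ two_pos hpos]; linarith
  · rw [div_le_one hpos]; exact h4
  · have := hO.slice_mem hc hpos h3
    rw [hL, inv_one, one_smul]
    rwa [smul_smul, ← div_eq_inv_mul] at this

lemma sum_abs_smul_single (l : Fin m → ℤ) :
    ∑ i, |(l i : ℝ)| • intVec (Pi.single i (-(l i).sign)) = -intVec l := by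
  ext j
  simp only [WithLp.ofLp_sum, Finset.sum_apply, PiLp.smul_apply, intVec_apply, PiLp.neg_apply,
    smul_eq_mul]
  rw [sum_eq_single j]
  · rw [Pi.single_eq_same]
    have : (|l j| * (l j).sign : ℤ) = l j := by rw [mul_comm, Int.sign_mul_abs]
    push_cast
    rw [mul_neg, neg_inj]
    exact_mod_cast this
  · intro i _ hij
    rw [Pi.single_eq_of_ne hij.symm]
    simp
  · simp

/-- Here `P` is the ℓ¹ norm of `l`. The unit step `-sign (l i) • e_i` may follow `l`, and with
weights `|l i|` these steps sum to `-l`, so the mixture moves along `(P - 1) • l`. -/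
lemma SmallBody.long_mem_slice (hO : SmallBody O z r) (hc : c ⬝ᵥ c = 1) (hf : Free O l)
    (hl : 2 ≤ l ⬝ᵥ l) :
    ∃ (s P : ℝ), ‖intVec l‖ ≤ P ∧ 2 ≤ P ∧
      ‖intVec l‖ * (P - 1) / (P * (‖intVec l‖ + 1)) ≤ s ∧ s ≤ 1 ∧
      (s • ‖intVec l‖⁻¹ • intVec l, (1 : ℝ)) ∈ asymptoticCone O c := by
  have hterm : ∀ i, ∃ τ : ℝ, τ ≤ ‖intVec l‖ + 1 ∧
      |(l i : ℝ)| • (intVec (l + Pi.single i (-(l i).sign)), τ) ∈ asymptoticCone O c := by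
    intro i
    by_cases hi : l i = 0
    · refine ⟨0, by positivity, ?_⟩
      rw [hi, Int.cast_zero, abs_zero, zero_smul]
      exact hO.zero_mem_cone hc
    · have he : (Pi.single i (-(l i).sign) : Fin m → ℤ) ⬝ᵥ Pi.single i (-(l i).sign) = 1 := by
        rcases lt_or_gt_of_ne hi with h | h
        · simp [Int.sign_eq_neg_one_of_neg h]
        · simp [Int.sign_eq_one_of_pos h]
      have hle : l ⬝ᵥ Pi.single i (-(l i).sign) ≤ 0 := by
        rw [dotProduct_single, mul_neg, mul_comm, Int.sign_mul_self_eq_abs]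
        simp
      obtain ⟨τ, h1, h2⟩ := hO.alternating_mem_cone hc hf (hO.free_unit he).1 hle
      rw [norm_intVec_of_unit he] at h1
      exact ⟨τ, h1, hO.smul_mem_cone hc h2 (abs_nonneg _)⟩
  choose τ hτ1 hτ2 using hterm
  have hsum : ∑ i, |(l i : ℝ)| • (intVec (l + Pi.single i (-(l i).sign)), τ i) ∈
      asymptoticCone O c :=
    Finset.sum_induction _ (· ∈ asymptoticCone O c) (fun _ _ => hO.add_mem_cone)
      (hO.zero_mem_cone hc) fun i _ => hτ2 i
  set P : ℝ := ∑ i, |(l i : ℝ)| with hP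
  have hP0 : 0 ≤ P := sum_nonneg fun _ _ => abs_nonneg _
  have hLP : ‖intVec l‖ ^ 2 ≤ P ^ 2 := by
    rw [EuclideanSpace.norm_sq_eq]
    simp only [intVec_apply, Real.norm_eq_abs]
    exact sum_sq_le_sq_sum_of_nonneg fun _ _ => abs_nonneg _
  have hL2 : 2 ≤ ‖intVec l‖ ^ 2 := by
    rw [norm_intVec_sq]; exact_mod_cast hl
  have hL0 : 0 < ‖intVec l‖ := by nlinarith [norm_nonneg (intVec l)]
  have hPint : P = ((∑ i, |l i| : ℤ) : ℝ) := by rw [hP]; push_cast; rfl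
  have hP2 : 2 ≤ P := by
    have h1 : 1 < P := by nlinarith
    rw [hPint] at h1 ⊢
    have h2 : (1 : ℤ) < ∑ i, |l i| := by exact_mod_cast h1
    exact_mod_cast h2
  set T : ℝ := ∑ i, |(l i : ℝ)| * τ i with hT
  have e : ∑ i, |(l i : ℝ)| • (intVec (l + Pi.single i (-(l i).sign)), τ i) =
      ((P - 1) • intVec l, T) := by
    refine Prod.ext ?_ ?_
    · rw [Prod.fst_sum]
      simp only [Prod.smul_mk, intVec_add, smul_add, sum_add_distrib, sum_abs_smul_single,
        ← sum_smul]
      rw [sub_smul, one_smul, sub_eq_add_neg]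
    · rw [Prod.snd_sum]
      rfl
  rw [e] at hsum
  have h4 := hO.norm_fst_le_of_mem_cone hsum
  rw [norm_smul, Real.norm_of_nonneg (by linarith)] at h4
  dsimp only at h4
  have hT1 : T ≤ P * (‖intVec l‖ + 1) := by
    rw [hT, hP, sum_mul]
    exact sum_le_sum fun i _ => mul_le_mul_of_nonneg_left (hτ1 i) (abs_nonneg _)
  have hPL : 0 < (P - 1) * ‖intVec l‖ := mul_pos (by linarith) hL0
  have hT0 : 0 < T := hPL.trans_le h4
  refine ⟨‖intVec l‖ * (P - 1) / T, P, abs_le_of_sq_le_sq hLP hP0 |> (le_abs_self _).trans, hP2,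
    ?_, ?_, ?_⟩
  · exact div_le_div_of_nonneg_left (by linarith) hT0 hT1
  · rw [div_le_one hT0]; linarith
  · have := hO.slice_mem hc hT0 hsum
    have e2 : ‖intVec l‖ * (P - 1) / T * ‖intVec l‖⁻¹ = T⁻¹ * (P - 1) := by field_simp
    rwa [smul_smul, e2, ← smul_smul]

/-- Every free vector yields a point of the slice in its direction, of norm at least `1 - √2 / 2`. -/
lemma SmallBody.mem_slice_of_free (hO : SmallBody O z r) (hc : c ⬝ᵥ c = 1) (hm : 2 ≤ m)
    (hf : Free O l) :
    ∃ s : ℝ, 1 - √2 / 2 ≤ s ∧ s ≤ 1 ∧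
      (s • ‖intVec l‖⁻¹ • intVec l, (1 : ℝ)) ∈ asymptoticCone O c := by
  have h2 : √2 ^ 2 = 2 := Real.sq_sqrt (by norm_num)
  have h20 : 0 ≤ √2 := Real.sqrt_nonneg 2
  have h21 : 1 ≤ √2 := by nlinarith
  rcases (one_le_dotProduct_self hf.1).eq_or_lt with h | h
  · obtain ⟨s, h1, h3⟩ := hO.unit_mem_slice hc hm h.symm
    exact ⟨s, by linarith, h3⟩
  · obtain ⟨s, P, h1, h3, h4, h5⟩ := hO.long_mem_slice hc hf h
    refine ⟨s, le_trans ?_ h4, h5⟩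
    have hL2 : 2 ≤ ‖intVec l‖ ^ 2 := by
      rw [norm_intVec_sq]; exact_mod_cast h
    have hL : √2 ≤ ‖intVec l‖ := Real.sqrt_le_iff.2 ⟨norm_nonneg _, hL2⟩
    generalize ‖intVec l‖ = L at *
    rw [le_div_iff₀ (mul_pos (by linarith) (by linarith))]
    -- Equivalent to `L ≥ √2`. The remaining factor comes from `P ≥ 2`, that is `P / 2 ≤ P - 1`.
    have a1 : (2 - √2) * (L + 1) ≤ L := by nlinarith
    have a2 : P / 2 * ((2 - √2) * (L + 1)) ≤ P / 2 * L :=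
      mul_le_mul_of_nonneg_left a1 (by linarith)
    nlinarith

/-- A free vector of norm at least `N` yields a point of norm at least `(N - 1) / (N + 1)`. -/
lemma SmallBody.mem_slice_of_le_norm (hO : SmallBody O z r) (hc : c ⬝ᵥ c = 1)
    (hf : Free O l) {N : ℝ} (hN : 2 ≤ N) (hl : N ≤ ‖intVec l‖) :
    ∃ s : ℝ, (N - 1) / (N + 1) ≤ s ∧ s ≤ 1 ∧
      (s • ‖intVec l‖⁻¹ • intVec l, (1 : ℝ)) ∈ asymptoticCone O c := by
  have h : 2 ≤ l ⬝ᵥ l := by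
    have h1 : (2 : ℝ) ≤ ‖intVec l‖ ^ 2 := by nlinarith
    rw [norm_intVec_sq] at h1
    exact_mod_cast h1
  obtain ⟨s, P, h1, h3, h4, h5⟩ := hO.long_mem_slice hc hf h
  refine ⟨s, le_trans ?_ h4, h5⟩
  generalize ‖intVec l‖ = L at *
  have hL : 0 < L := by linarith
  -- The first step is monotonicity in `N ≤ L`; the second is `(L - 1) / L ≤ (P - 1) / P`, from `L ≤
  -- P`.
  calc (N - 1) / (N + 1) ≤ (L - 1) / (L + 1) := by
        rw [div_le_div_iff₀ (by linarith) (by linarith)]; nlinarith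
    _ ≤ L * (P - 1) / (P * (L + 1)) := by
        rw [div_le_div_iff₀ (by linarith) (mul_pos (by linarith) (by linarith))]; nlinarith

end Free

end

section

open Finset InnerProductGeometry

variable {m : ℕ}

/-! ### The function `η` -/

lemma arcsin_le_pi_div_two_mul {y : ℝ} (hy : 0 ≤ y) : Real.arcsin y ≤ Real.pi / 2 * y := by
  have hp := Real.pi_pos
  rcases le_total y 1 with h1 | h1
  · have h := Real.mul_le_sin (Real.arcsin_nonneg.2 hy) (Real.arcsin_le_pi_div_two y)
    rw [Real.sin_arcsin (by linarith) h1] at h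
    have h2 := mul_le_mul_of_nonneg_left h (by positivity : 0 ≤ Real.pi / 2)
    have h3 : Real.pi / 2 * (2 / Real.pi * Real.arcsin y) = Real.arcsin y := by field_simp
    linarith
  · nlinarith [Real.arcsin_le_pi_div_two y]

lemma div_two_zpow (r : ℝ) (n : ℕ) : r / (2 : ℝ) ^ ((n : ℤ) - 1) = 2 * r / 2 ^ n := by
  rw [zpow_sub_one₀ (by norm_num), zpow_natCast]
  field_simp

lemma eta_term_nonneg {r : ℝ} (hr : 0 ≤ r) (n : ℕ) :
    0 ≤ Real.arcsin (r / (2 : ℝ) ^ ((n : ℤ) - 1)) :=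
  Real.arcsin_nonneg.2 (by positivity)

lemma eta_nonneg {r : ℝ} (hr : 0 ≤ r) : 0 ≤ eta r := tsum_nonneg (eta_term_nonneg hr)

lemma eta_pos {r : ℝ} (hr : 0 < r) : 0 < eta r :=
  (summable_eta r).tsum_pos (eta_term_nonneg hr.le) 0 (Real.arcsin_pos.2 (by positivity))

lemma eta_le {r : ℝ} (hr : 0 ≤ r) : eta r ≤ 2 * Real.pi * r := by
  have h1 : HasSum (fun n : ℕ => Real.pi * r * (1 / 2 : ℝ) ^ n) (Real.pi * r * 2) :=
    hasSum_geometric_two.mul_left _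
  have h2 : eta r ≤ Real.pi * r * 2 := by
    rw [← h1.tsum_eq]
    refine (summable_eta r).tsum_le_tsum (fun n => ?_) h1.summable
    refine (arcsin_le_pi_div_two_mul (by positivity)).trans (le_of_eq ?_)
    rw [div_two_zpow, one_div, inv_pow]
    field_simp
  linarith

/-! ### Free vectors are nearly dense in the sphere of directions -/

variable {O : Set (EuclideanSpace ℝ (Fin m))} {z : EuclideanSpace ℝ (Fin m)} {r : ℝ}

/-- The hypothesis `h` bounds the distance from `l` to the line through `k` by `2 * r`, so the sine
of the angle is at most `2 * r / ‖l‖`, with `‖l‖ ≥ 2 ^ n`. Positivity of `l ⬝ᵥ k` makes the angle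
acute. -/
lemma angle_le_arcsin_of_halfway {k l : Fin m → ℤ} {r : ℝ} (hr : 0 ≤ r) (hlk : 0 < l ⬝ᵥ k)
    (h : ((l ⬝ᵥ l : ℤ) : ℝ) * (k ⬝ᵥ k : ℤ) - ((l ⬝ᵥ k : ℤ) : ℝ) ^ 2 ≤ 4 * r ^ 2 * (k ⬝ᵥ k : ℤ))
    {n : ℕ} (hn : 4 ^ n ≤ l ⬝ᵥ l) :
    angle (intVec l) (intVec k) ≤ Real.arcsin (r / (2 : ℝ) ^ ((n : ℤ) - 1)) := by
  have hl0 : l ≠ 0 := by rintro rfl; simp at hlk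
  have hk0 : k ≠ 0 := by rintro rfl; simp at hlk
  have hl : 0 < ‖intVec l‖ := norm_pos_iff.2 (intVec_ne_zero hl0)
  have hk : 0 < ‖intVec k‖ := norm_pos_iff.2 (intVec_ne_zero hk0)
  have hle : angle (intVec l) (intVec k) ≤ Real.pi / 2 := by
    rw [angle, Real.arccos_le_pi_div_two, inner_intVec]
    have : (0 : ℝ) ≤ ((l ⬝ᵥ k : ℤ) : ℝ) := by exact_mod_cast hlk.le
    positivity
  have hsin := sin_angle_mul_norm_mul_norm (intVec l) (intVec k)
  have hroot : √(inner ℝ (intVec l) (intVec l) * inner ℝ (intVec k) (intVec k) -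
      inner ℝ (intVec l) (intVec k) * inner ℝ (intVec l) (intVec k)) ≤ 2 * r * ‖intVec k‖ := by
    rw [Real.sqrt_le_left (by positivity), mul_pow, norm_intVec_sq]
    simp only [inner_intVec]
    linarith
  have hn' : (2 : ℝ) ^ n ≤ ‖intVec l‖ := by
    refine le_of_sq_le_sq ?_ hl.le
    rw [norm_intVec_sq, ← pow_mul, mul_comm, pow_mul]
    norm_num
    exact_mod_cast hn
  have h1 : Real.sin (angle (intVec l) (intVec k)) ≤ 2 * r / 2 ^ n := by
    rw [le_div_iff₀ (by positivity)]
    have h2 := hsin.le.trans hroot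
    rw [← mul_assoc] at h2
    have h3 := le_of_mul_le_mul_right h2 hk
    exact (mul_le_mul_of_nonneg_left hn' (sin_angle_nonneg _ _)).trans h3
  rw [div_two_zpow]
  calc angle (intVec l) (intVec k)
      = Real.arcsin (Real.sin (angle (intVec l) (intVec k))) :=
        (Real.arcsin_sin (by linarith [angle_nonneg (intVec l) (intVec k), Real.pi_pos]) hle).symm
    _ ≤ _ := Real.monotone_arcsin h1

/-- Induction on a bound for the squared norm. The number `n` counts the descent steps that actually
change direction. Each step gives `4 * (l ⬝ᵥ l) - 1 ≤ k ⬝ᵥ k`, and because of the loss of 1 a plain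
bound by `4 ^ n` would not propagate. The affine invariant does, it equals 5 at `n = 1`, and it
implies `4 ^ n ≤ k ⬝ᵥ k`, which the next summand requires. -/
lemma SmallBody.exists_free_angle_le_sum (hO : SmallBody O z r) (a : ℕ) :
    ∀ k : Fin m → ℤ, k ≠ 0 → k ⬝ᵥ k ≤ a → ∃ (l : Fin m → ℤ) (n : ℕ), Free O l ∧
      angle (intVec l) (intVec k) ≤ ∑ i ∈ range n, Real.arcsin (r / (2 : ℝ) ^ ((i : ℤ) - 1)) ∧
      (n = 0 ∨ 13 * 4 ^ n + 8 ≤ 12 * (k ⬝ᵥ k)) := by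
  induction a with
  | zero =>
    intro k hk hka
    have := one_le_dotProduct_self hk
    push_cast at hka
    omega
  | succ a ih =>
    intro k hk hka
    by_cases hf : Free O k
    · exact ⟨k, 0, hf, by simp [angle_self (intVec_ne_zero hk)], Or.inl rfl⟩
    obtain ⟨l, h1, h2, h3⟩ := hO.exists_halfway hk hf
    have hl : l ≠ 0 := by rintro rfl; simp at h1
    have hA := one_le_dotProduct_self hk
    have hB := one_le_dotProduct_self hl
    have h4 : 2 * ((l ⬝ᵥ l) * (k ⬝ᵥ k)) - 2 * (l ⬝ᵥ k) ^ 2 < k ⬝ᵥ k := by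
      have h5 : (1 : ℝ) ≤ ((k ⬝ᵥ k : ℤ) : ℝ) := by exact_mod_cast hA
      have h6 : 2 * (((l ⬝ᵥ l : ℤ) : ℝ) * (k ⬝ᵥ k : ℤ)) - 2 * ((l ⬝ᵥ k : ℤ) : ℝ) ^ 2 <
          (k ⬝ᵥ k : ℤ) := by
        nlinarith [hO.four_mul_sq_lt]
      exact_mod_cast h6
    have h5 : 4 * (l ⬝ᵥ l) - 2 < k ⬝ᵥ k := by nlinarith
    obtain ⟨l', n, hf', hang, hn⟩ := ih l hl (by push_cast at hka; omega)
    have htri := angle_le_angle_add_angle (intVec l') (intVec l) (intVec k)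
    by_cases hpar : (l ⬝ᵥ l) * (k ⬝ᵥ k) = (l ⬝ᵥ k) ^ 2
    · refine ⟨l', n, hf', ?_, by omega⟩
      -- In the parallel case the distance to the line is zero, so the angle vanishes and no summand
      -- is spent.
      have h0 := angle_le_arcsin_of_halfway (r := 0) le_rfl h1 (n := 0)
        (by rw [← Int.cast_mul, hpar]; simp) (by simpa using hB)
      simp only [zero_div, Real.arcsin_zero] at h0
      linarith
    · have hCS : (l ⬝ᵥ k) ^ 2 < (l ⬝ᵥ l) * (k ⬝ᵥ k) := by
        refine lt_of_le_of_ne ?_ (Ne.symm hpar)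
        have := real_inner_mul_inner_self_le (intVec l) (intVec k)
        simp only [inner_intVec] at this
        rw [sq]
        exact_mod_cast this
      refine ⟨l', n + 1, hf', ?_, Or.inr ?_⟩
      · rw [sum_range_succ]
        have := angle_le_arcsin_of_halfway hO.radius_nonneg h1 h3 (n := n) (by
          rcases hn with rfl | hn
          · simpa using hB
          · have : (0 : ℤ) < 4 ^ n := by positivity
            omega)
        linarith
      · rcases hn with rfl | hn
        -- The first step that changes direction starts the invariant: squared norms up to 4 are
        -- excluded by the halfway bounds together with strict Cauchy–Schwarz.
        · suffices 5 ≤ k ⬝ᵥ k by norm_num; omega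
          generalize k ⬝ᵥ k = A at *
          generalize l ⬝ᵥ k = C at *
          generalize l ⬝ᵥ l = B at *
          by_contra! hlt
          obtain rfl : B = 1 := by omega
          have : C = 1 ∨ C = 2 := by omega
          rcases this with rfl | rfl <;> omega
        · rw [pow_succ]
          omega

lemma tendsto_inv_smul_intVec_floor (u : EuclideanSpace ℝ (Fin m)) :
    Filter.Tendsto (fun n : ℕ => ((n : ℝ) + 1)⁻¹ • intVec fun i => ⌊((n : ℝ) + 1) * u i⌋)
      Filter.atTop (nhds u) := by
  have h : Filter.Tendsto (fun (n : ℕ) (i : Fin m) => ((n : ℝ) + 1)⁻¹ * ⌊((n : ℝ) + 1) * u i⌋)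
      Filter.atTop (nhds u.ofLp) := by
    rw [tendsto_pi_nhds]
    intro i
    rw [tendsto_iff_norm_sub_tendsto_zero]
    refine squeeze_zero (fun _ => norm_nonneg _) (fun n => ?_)
      (tendsto_one_div_add_atTop_nhds_zero_nat (𝕜 := ℝ))
    have hn : (0 : ℝ) < (n : ℝ) + 1 := by positivity
    have h1 := Int.floor_le (((n : ℝ) + 1) * u i)
    have h2 := Int.lt_floor_add_one (((n : ℝ) + 1) * u i)
    have e : ((n : ℝ) + 1)⁻¹ * ⌊((n : ℝ) + 1) * u i⌋ - u i =
        (⌊((n : ℝ) + 1) * u i⌋ - ((n : ℝ) + 1) * u i) / ((n : ℝ) + 1) := by field_simp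
    rw [e, Real.norm_eq_abs, abs_div, abs_of_pos hn]
    refine div_le_div_of_nonneg_right (abs_le.2 ⟨?_, ?_⟩) hn.le <;> linarith
  exact ((PiLp.continuous_toLp 2 _).tendsto _).comp h

lemma tendsto_angle_left {E : Type*} [NormedAddCommGroup E] [InnerProductSpace ℝ E] {u : E}
    (hu : u ≠ 0) : Filter.Tendsto (fun x => angle x u) (nhds u) (nhds 0) := by
  have h1 : ContinuousAt (fun x => angle x u) u := by
    unfold angle
    have : ‖u‖ * ‖u‖ ≠ 0 := by simp [hu]
    fun_prop (disch := assumption)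
  have h2 := h1.tendsto
  rwa [angle_self hu] at h2

/-- Every direction makes an angle at most `η(r)`, up to an arbitrarily small error, with some
free vector. -/
lemma SmallBody.exists_free_angle_le (hO : SmallBody O z r) {u : EuclideanSpace ℝ (Fin m)}
    (hu : u ≠ 0) {ε : ℝ} (hε : 0 < ε) :
    ∃ l, Free O l ∧ angle (intVec l) u ≤ eta r + ε := by
  have hlim := tendsto_inv_smul_intVec_floor u
  have hcont := tendsto_angle_left hu
  have hev := (hcont.comp hlim).eventually_lt_const hε
  have hev' := hlim.eventually_ne hu
  obtain ⟨n, hn1, hn2⟩ := (hev.and hev').exists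
  set k : Fin m → ℤ := fun i => ⌊((n : ℝ) + 1) * u i⌋ with hk
  have hk0 : k ≠ 0 := by
    intro h0
    rw [h0] at hn2
    simp at hn2
  simp only [Function.comp_apply, angle_smul_left_of_pos _ _
    (by positivity : (0 : ℝ) < ((n : ℝ) + 1)⁻¹)] at hn1
  obtain ⟨l, j, h1, h2, -⟩ := hO.exists_free_angle_le_sum (k ⬝ᵥ k).toNat k hk0
    (Int.self_le_toNat _)
  refine ⟨l, h1, ?_⟩
  have h3 := angle_le_angle_add_angle (intVec l) (intVec k) u
  have h4 : ∑ i ∈ range j, Real.arcsin (r / (2 : ℝ) ^ ((i : ℤ) - 1)) ≤ eta r :=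
    (summable_eta r).sum_le_tsum _ fun i _ => eta_term_nonneg hO.radius_nonneg i
  linarith

end

section

open Finset InnerProductGeometry

variable {m : ℕ}

/-! ### Small angles between integer vectors -/

lemma bddBelow_integerAngles (N : ℕ) : BddBelow (integerAngles N) := ⟨0, fun _ h => h.1.le⟩

lemma beta_le {N : ℕ} {θ : ℝ} (h : θ ∈ integerAngles N) : beta N ≤ θ :=
  csInf_le (bddBelow_integerAngles N) h

lemma nonempty_of_beta_pos {N : ℕ} (h : 0 < beta N) : (integerAngles N).Nonempty := by
  by_contra hn
  rw [Set.not_nonempty_iff_eq_empty] at hn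
  -- The infimum of the empty set is 0 by convention, so a positive `beta` certifies that angles
  -- exist.
  rw [beta, hn, Real.sInf_empty] at h
  exact h.false

lemma beta_le_pi {N : ℕ} (h : 0 < beta N) : beta N ≤ Real.pi := by
  obtain ⟨θ, hθ⟩ := nonempty_of_beta_pos h
  refine (beta_le hθ).trans ?_
  obtain ⟨-, d, u, v, -, -, -, -, rfl⟩ := hθ
  exact angle_le_pi _ _

lemma angle_eq_zero_of_lt_beta {N : ℕ} {u v : Fin m → ℤ} (hu0 : u ≠ 0) (hv0 : v ≠ 0)
    (hu : ‖intVec u‖ < N) (hv : ‖intVec v‖ < N) (h : angle (intVec u) (intVec v) < beta N) :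
    angle (intVec u) (intVec v) = 0 := by
  by_contra hne
  have hpos := lt_of_le_of_ne (angle_nonneg (intVec u) (intVec v)) (Ne.symm hne)
  exact absurd (beta_le ⟨hpos, m, u, v, hu0, hv0, hu, hv, rfl⟩) (not_le.2 h)

/-- An angle is determined by the three integers `u ⬝ᵥ v`, `u ⬝ᵥ u`, `v ⬝ᵥ v`, each of absolute
value at most `N ^ 2`, whatever the dimension. This is why `beta` is a minimum, positive and uniform
in the dimension. -/
lemma finite_integerAngles (N : ℕ) : (integerAngles N).Finite := by
  have hfin : (Set.Icc (-(N : ℤ) ^ 2) ((N : ℤ) ^ 2)).Finite := Set.finite_Icc _ _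
  refine ((hfin.prod (hfin.prod hfin)).image
    fun p : ℤ × ℤ × ℤ => Real.arccos (p.1 / (√p.2.1 * √p.2.2))).subset ?_
  rintro θ ⟨-, d, u, v, -, -, hu, hv, rfl⟩
  have hsq : ∀ w : Fin d → ℤ, ‖intVec w‖ < N → w ⬝ᵥ w ≤ (N : ℤ) ^ 2 := by
    intro w hw
    have := pow_le_pow_left₀ (norm_nonneg _) hw.le 2
    rw [norm_intVec_sq] at this
    exact_mod_cast this
  have hcs := abs_real_inner_le_norm (intVec u) (intVec v)
  rw [inner_intVec, ← Int.cast_abs] at hcs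
  have hc : |u ⬝ᵥ v| ≤ (N : ℤ) ^ 2 := by
    have h1 : ‖intVec u‖ * ‖intVec v‖ ≤ N * N :=
      mul_le_mul hu.le hv.le (norm_nonneg _) (Nat.cast_nonneg _)
    have h2 := hcs.trans h1
    rw [← sq] at h2
    exact_mod_cast h2
  have hnn : (0 : ℤ) ≤ (N : ℤ) ^ 2 := by positivity
  refine ⟨(u ⬝ᵥ v, u ⬝ᵥ u, v ⬝ᵥ v), ⟨abs_le.1 hc, ⟨?_, hsq u hu⟩, ?_, hsq v hv⟩, ?_⟩
  · linarith [dotProduct_self_nonneg u]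
  · linarith [dotProduct_self_nonneg v]
  · simp only [← norm_intVec_sq, Real.sqrt_sq (norm_nonneg _), ← inner_intVec]
    rfl

/-- Witnessed by `(a, 0)` and `(a, 1)`, at angle `arctan (1 / a)`. It forces `beta` to tend to 0,
which bounds the candidates for `N(r)`. -/
lemma exists_mem_integerAngles {a N : ℕ} (ha : 0 < a) (hN : a + 2 ≤ N) :
    ∃ θ ∈ integerAngles N, θ ≤ 1 / (a : ℝ) := by
  have ha' : (0 : ℝ) < a := by exact_mod_cast ha
  have hN' : (a : ℝ) + 2 ≤ N := by exact_mod_cast hN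
  set u : Fin 2 → ℤ := ![(a : ℤ), 0] with hu
  set v : Fin 2 → ℤ := ![0, 1] with hv
  have hu0 : u ≠ 0 := fun h => by
    have := congrFun h 0
    simp [hu] at this
    omega
  have huv0 : u + v ≠ 0 := fun h => by
    have := congrFun h 1
    simp [hu, hv] at this
  have hun : ‖intVec u‖ = a := by
    rw [EuclideanSpace.norm_eq, Fin.sum_univ_two]
    simp [hu]
  have hvn : ‖intVec v‖ = 1 := by
    rw [EuclideanSpace.norm_eq, Fin.sum_univ_two]
    simp [hv]
  have hin : inner ℝ (intVec u) (intVec v) = 0 := by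
    rw [inner_intVec]
    simp [hu, hv]
  have hang := angle_add_eq_arctan_of_inner_eq_zero hin (intVec_ne_zero hu0)
  rw [hun, hvn, ← intVec_add] at hang
  have hle := norm_add_le (intVec u) (intVec v)
  rw [← intVec_add] at hle
  refine ⟨Real.arctan (1 / a), ⟨Real.arctan_pos.2 (by positivity), 2, u, u + v, hu0, huv0,
    by linarith, by linarith, hang⟩, ?_⟩
  have h1 := Real.le_tan (Real.arctan_pos.2 (by positivity : (0 : ℝ) < 1 / a)).le
    (Real.arctan_lt_pi_div_two _)
  rwa [Real.tan_arctan] at h1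

lemma beta_pos {N : ℕ} (hN : 3 ≤ N) : 0 < beta N := by
  obtain ⟨θ, hθ, -⟩ := exists_mem_integerAngles one_pos hN
  exact (Set.Nonempty.csInf_mem ⟨θ, hθ⟩ (finite_integerAngles N)).1

/-- The bound `eta r ≤ 2 * π * r` makes `max K 3` a candidate for small `r`, while `eta r > 0` and
the decay of `beta` bound the candidates above. -/
theorem exists_isNOf (K : ℕ) :
    ∃ r₀ : ℝ, 0 < r₀ ∧ ∀ r : ℝ, 0 < r → r < r₀ → ∃ N : ℕ, IsNOf r N ∧ K ≤ N := by
  have hb : 0 < beta (max K 3) := beta_pos (le_max_right _ _)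
  have hpi := Real.pi_pos
  refine ⟨beta (max K 3) / (4 * Real.pi), by positivity, fun r hr hr' => ?_⟩
  rw [lt_div_iff₀ (by positivity)] at hr'
  have hmem : max K 3 ∈ {n : ℕ | 1 < n ∧ eta r < beta n / 2} := by
    refine ⟨lt_of_lt_of_le (by norm_num) (le_max_right K 3), ?_⟩
    linarith [eta_le hr.le]
  have hη := eta_pos hr
  obtain ⟨a, ha⟩ := exists_nat_gt (1 / eta r)
  have ha0 : (0 : ℝ) < a := lt_trans (by positivity) ha
  have hbdd : BddAbove {n : ℕ | 1 < n ∧ eta r < beta n / 2} := by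
    refine ⟨a + 2, fun n hn => ?_⟩
    by_contra! hlt
    obtain ⟨θ, h1, h2⟩ := exists_mem_integerAngles (by exact_mod_cast ha0) hlt.le
    have h3 : 1 / (a : ℝ) < eta r := by
      rw [div_lt_iff₀ hη] at ha
      rw [div_lt_iff₀ ha0]
      linarith
    linarith [beta_le h1, hn.2]
  exact ⟨_, ⟨Nat.sSup_mem ⟨_, hmem⟩ hbdd, fun n hn => le_csSup hbdd hn⟩,
    (le_max_left K 3).trans (le_csSup hbdd hmem)⟩

/-! ### Rotating a unit vector -/

lemma exists_unit_orthogonal (hm : 2 ≤ m) (e : EuclideanSpace ℝ (Fin m)) :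
    ∃ f : EuclideanSpace ℝ (Fin m), ‖f‖ = 1 ∧ inner ℝ e f = 0 := by
  have h1 : (Submodule.span ℝ {e})ᗮ ≠ ⊥ := by
    intro h
    have h2 := (Submodule.span ℝ {e}).finrank_add_finrank_orthogonal
    rw [h, finrank_bot, finrank_euclideanSpace_fin] at h2
    have h3 : Module.finrank ℝ (Submodule.span ℝ {e}) ≤ 1 := by
      simpa using finrank_span_le_card (R := ℝ) ({e} : Set (EuclideanSpace ℝ (Fin m)))
    omega
  obtain ⟨f, hf, hf0⟩ := Submodule.exists_mem_ne_zero_of_ne_bot h1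
  rw [Submodule.mem_orthogonal_singleton_iff_inner_right] at hf
  refine ⟨‖f‖⁻¹ • f, ?_, ?_⟩
  · rw [norm_smul, norm_inv, norm_norm, inv_mul_cancel₀ (norm_ne_zero_iff.2 hf0)]
  · rw [real_inner_smul_right, hf, mul_zero]

/-- Rotate the unit vector `u` away from `x` until the angle with `x` is `θ`. -/
lemma exists_rotate (hm : 2 ≤ m) {x u : EuclideanSpace ℝ (Fin m)} (hx : x ≠ 0) (hu : ‖u‖ = 1)
    {θ : ℝ} (h1 : angle x u ≤ θ) (h2 : θ ≤ Real.pi) :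
    ∃ v : EuclideanSpace ℝ (Fin m), v ≠ 0 ∧ angle x v = θ ∧ angle v u = θ - angle x u := by
  have hx0 : 0 < ‖x‖ := norm_pos_iff.2 hx
  set e := ‖x‖⁻¹ • x with he
  have hen : ‖e‖ = 1 := by rw [he, norm_smul, norm_inv, norm_norm, inv_mul_cancel₀ hx0.ne']
  have hang : ∀ y, angle x y = angle e y := fun y =>
    (angle_smul_left_of_pos x y (inv_pos.2 hx0)).symm
  rw [hang] at h1 ⊢
  simp only [hang]
  set α := angle e u with hα
  have hα0 : 0 ≤ α := angle_nonneg _ _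
  have hcos : inner ℝ e u = Real.cos α := by
    rw [hα, cos_angle, hen, hu, mul_one, div_one]
  have hsq : ‖u - Real.cos α • e‖ ^ 2 = Real.sin α ^ 2 := by
    rw [norm_sub_sq_real, norm_smul, real_inner_smul_right, real_inner_comm, hcos, hen, hu,
      Real.sin_sq, Real.norm_eq_abs, mul_one, sq_abs]
    ring
  obtain ⟨f, hf1, hf2, hf3⟩ : ∃ f : EuclideanSpace ℝ (Fin m), ‖f‖ = 1 ∧ inner ℝ e f = 0 ∧
      u = Real.cos α • e + Real.sin α • f := by
    -- If `u = ±e`, the plane of rotation is not determined, and any orthogonal direction serves;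
    -- this requires dimension at least 2.
    by_cases hs : Real.sin α = 0
    · obtain ⟨f, hf1, hf2⟩ := exists_unit_orthogonal hm e
      refine ⟨f, hf1, hf2, ?_⟩
      rw [hs] at hsq ⊢
      have : u - Real.cos α • e = 0 := by simpa using hsq
      rw [zero_smul, add_zero]
      exact sub_eq_zero.1 this
    · refine ⟨(Real.sin α)⁻¹ • (u - Real.cos α • e), ?_, ?_, ?_⟩
      · have h3 : ‖u - Real.cos α • e‖ = |Real.sin α| := by
          rw [← abs_norm]; exact (sq_eq_sq_iff_abs_eq_abs _ _).1 hsq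
        rw [norm_smul, h3, norm_inv, Real.norm_eq_abs, inv_mul_cancel₀ (abs_ne_zero.2 hs)]
      · rw [real_inner_smul_right, inner_sub_right, real_inner_smul_right, hcos,
          real_inner_self_eq_norm_sq, hen]
        ring
      · rw [smul_inv_smul₀ hs]; abel
  have hee : inner ℝ e e = (1 : ℝ) := by rw [real_inner_self_eq_norm_sq, hen, one_pow]
  have hff : inner ℝ f f = (1 : ℝ) := by rw [real_inner_self_eq_norm_sq, hf1, one_pow]
  have hfe : inner ℝ f e = (0 : ℝ) := by rw [real_inner_comm, hf2]
  set v := Real.cos θ • e + Real.sin θ • f with hv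
  have hvn : ‖v‖ = 1 := by
    have : ‖v‖ ^ 2 = 1 := by
      rw [← real_inner_self_eq_norm_sq, hv]
      simp only [inner_add_left, inner_add_right, real_inner_smul_left, real_inner_smul_right, hee,
        hff, hfe, hf2]
      linarith [Real.cos_sq_add_sin_sq θ]
    exact (pow_eq_one_iff_of_nonneg (norm_nonneg _) two_ne_zero).1 this
  refine ⟨v, norm_ne_zero_iff.1 (by rw [hvn]; exact one_ne_zero), ?_, ?_⟩
  · rw [angle, hen, hvn, mul_one, div_one, hv]
    simp only [inner_add_right, real_inner_smul_right, hee, hf2, mul_one, mul_zero, add_zero]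
    exact Real.arccos_cos (hα0.trans h1) h2
  · rw [angle, hvn, hu, mul_one, div_one]
    have : inner ℝ v u = Real.cos (θ - α) := by
      rw [hv, hf3, Real.cos_sub]
      simp only [inner_add_left, inner_add_right, real_inner_smul_left, real_inner_smul_right, hee,
        hff, hfe, hf2]
      ring
    rw [this]
    exact Real.arccos_cos (by linarith) (by linarith)

/-! ### Balls in the admissible rotation set -/

section Balls

variable {O : Set (EuclideanSpace ℝ (Fin m))} {z : EuclideanSpace ℝ (Fin m)} {r : ℝ}

/-- If the free vector `l₁` near `u` is short, `u` is rotated to a `v` at angle exactly `eta r + 2 *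
γ` from `l₁`. A free `l` within `eta r + γ` of `v` is then less than `beta N` from `l₁` but not
parallel to it, hence cannot be short as well. -/
lemma SmallBody.exists_long_free_angle_le (hO : SmallBody O z r) (hm : 2 ≤ m) {N : ℕ}
    (hN : eta r < beta N / 2) {u : EuclideanSpace ℝ (Fin m)} (hu : ‖u‖ = 1) {ε : ℝ} (hε : 0 < ε) :
    ∃ l, Free O l ∧ (N : ℝ) ≤ ‖intVec l‖ ∧ angle (intVec l) u ≤ 2 * eta r + ε := by
  have hη := eta_nonneg hO.radius_nonneg
  have hβ := beta_le_pi (N := N) (by linarith)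
  obtain ⟨γ, hγ0, hγ1, hγ2⟩ : ∃ γ : ℝ, 0 < γ ∧ 3 * γ ≤ ε ∧ 2 * eta r + 3 * γ < beta N := by
    refine ⟨min (ε / 3) ((beta N - 2 * eta r) / 4), lt_min (by positivity) (by linarith), ?_, ?_⟩
    · linarith [min_le_left (ε / 3) ((beta N - 2 * eta r) / 4)]
    · linarith [min_le_right (ε / 3) ((beta N - 2 * eta r) / 4)]
  have hu0 : u ≠ 0 := norm_ne_zero_iff.1 (by rw [hu]; exact one_ne_zero)
  obtain ⟨l₁, hf₁, h₁⟩ := hO.exists_free_angle_le hu0 hγ0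
  rcases le_or_gt (N : ℝ) ‖intVec l₁‖ with hl₁ | hl₁
  · exact ⟨l₁, hf₁, hl₁, by linarith⟩
  obtain ⟨v, hv0, hv1, hv2⟩ := exists_rotate hm (intVec_ne_zero hf₁.1) hu
    (θ := eta r + 2 * γ) (by linarith) (by linarith)
  obtain ⟨l, hf, h⟩ := hO.exists_free_angle_le hv0 hγ0
  refine ⟨l, hf, ?_, ?_⟩
  · by_contra! hl
    have h3 := angle_le_angle_add_angle (intVec l) v (intVec l₁)
    rw [angle_comm v, hv1] at h3
    have h4 := angle_eq_zero_of_lt_beta hf.1 hf₁.1 hl hl₁ (by linarith)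
    have h5 := angle_le_angle_add_angle (intVec l₁) (intVec l) v
    rw [angle_comm (intVec l₁) (intVec l), h4] at h5
    linarith
  · linarith [angle_le_angle_add_angle (intVec l) v u, angle_nonneg (intVec l₁) u]

lemma SmallBody.closedBall_subset_of_angle (hO : SmallBody O z r) {c : Fin m → ℤ}
    (hc : c ⬝ᵥ c = 1) {κ θ : ℝ} (hκ : 0 < κ) (hθ : θ < Real.pi)
    (h : ∀ u : EuclideanSpace ℝ (Fin m), ‖u‖ = 1 → ∀ ε : ℝ, 0 < ε → ∃ (l : Fin m → ℤ) (s : ℝ),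
      angle (intVec l) u ≤ θ + ε ∧ κ ≤ s ∧ s ≤ 1 ∧
      (s • ‖intVec l‖⁻¹ • intVec l, (1 : ℝ)) ∈ asymptoticCone O c ∧ l ≠ 0) :
    Metric.closedBall 0 (κ * Real.cos θ) ⊆ admissibleRotationSet O := by
  rcases lt_or_ge (κ * Real.cos θ) 0 with hneg | hnn
  · rw [Metric.closedBall_eq_empty.2 hneg]; exact Set.empty_subset _
  refine hO.closedBall_subset hc fun u hu δ hδ => ?_
  -- The cap `π - θ` keeps the angle in the range where cosine decreases. Cosine is 1-Lipschitz and
  -- `s ≤ 1`, so the loss is at most `δ`.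
  obtain ⟨l, s, h1, h2, h3, h4, h5⟩ := h u hu (min δ (Real.pi - θ)) (lt_min hδ (by linarith))
  refine ⟨_, h4, ?_⟩
  have hl : ‖intVec l‖ ≠ 0 := norm_ne_zero_iff.2 (intVec_ne_zero h5)
  have e : inner ℝ (s • ‖intVec l‖⁻¹ • intVec l) u = s * Real.cos (angle (intVec l) u) := by
    rw [cos_angle, hu, mul_one, real_inner_smul_left, real_inner_smul_left]
    ring
  rw [e]
  have m1 := min_le_left δ (Real.pi - θ)
  have m2 := min_le_right δ (Real.pi - θ)
  have h6 : Real.cos (θ + min δ (Real.pi - θ)) ≤ Real.cos (angle (intVec l) u) :=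
    Real.cos_le_cos_of_nonneg_of_le_pi (angle_nonneg _ _) (by linarith) h1
  have h7 := (abs_le.1 (Real.abs_cos_sub_cos_le (θ + min δ (Real.pi - θ)) θ)).1
  rw [add_sub_cancel_left, abs_of_pos (lt_min hδ (by linarith))] at h7
  have h8 : Real.cos θ - δ ≤ Real.cos (angle (intVec l) u) := by linarith
  have hs : 0 ≤ s := hκ.le.trans h2
  have h9 : κ * Real.cos θ ≤ s * Real.cos θ := by
    have : 0 ≤ Real.cos θ := nonneg_of_mul_nonneg_right hnn hκ
    exact mul_le_mul_of_nonneg_right h2 this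
  nlinarith [mul_le_mul_of_nonneg_left h8 hs]

end Balls

end

/-! ### The explicit balls and the limit of the largest radius -/

section

open Finset InnerProductGeometry

variable {m : ℕ} {O : Set (EuclideanSpace ℝ (Fin m))} {z : EuclideanSpace ℝ (Fin m)} {r : ℝ}

lemma IsObstacle.smallBody (hO : IsObstacle O) (hr : r < √2 / 4) (hz : O ⊆ Metric.closedBall z r) :
    SmallBody O z r :=
  ⟨hO.isCompact, hO.strictConvex.convex, hO.interior_nonempty.mono interior_subset, hr, hz⟩

lemma exists_unit (hm : 2 ≤ m) : ∃ c : Fin m → ℤ, c ⬝ᵥ c = 1 :=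
  ⟨Pi.single ⟨0, by omega⟩ 1, by simp⟩

lemma SmallBody.eta_lt_pi (hO : SmallBody O z r) : eta r < Real.pi := by
  have h1 := eta_le hO.radius_nonneg
  have h2 : 2 * r < 1 := by nlinarith [hO.four_mul_sq_lt, hO.radius_nonneg]
  nlinarith [Real.pi_pos]

theorem SmallBody.closedBall_subset_cos_eta (hO : SmallBody O z r) (hm : 2 ≤ m) :
    Metric.closedBall 0 ((1 - √2 / 2) * Real.cos (eta r)) ⊆ admissibleRotationSet O := by
  obtain ⟨c, hc⟩ := exists_unit hm
  have h2 : √2 < 2 := by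
    rw [Real.sqrt_lt' two_pos]; norm_num
  refine hO.closedBall_subset_of_angle hc (by linarith) hO.eta_lt_pi fun u hu ε hε => ?_
  obtain ⟨l, h3, h4⟩ := hO.exists_free_angle_le
    (norm_ne_zero_iff.1 (by rw [hu]; exact one_ne_zero)) hε
  obtain ⟨s, h5, h6, h7⟩ := hO.mem_slice_of_free hc hm h3
  exact ⟨l, s, h4, h5, h6, h7, h3.1⟩

theorem SmallBody.closedBall_subset_cos_two_mul_eta (hO : SmallBody O z r) (hm : 2 ≤ m) {N : ℕ}
    (hN : IsNOf r N) :
    Metric.closedBall 0 ((((N : ℝ) - 1) / ((N : ℝ) + 1)) * Real.cos (2 * eta r)) ⊆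
      admissibleRotationSet O := by
  obtain ⟨c, hc⟩ := exists_unit hm
  obtain ⟨⟨hN1, hN2⟩, -⟩ := hN
  have hN3 : (2 : ℝ) ≤ N := by exact_mod_cast hN1
  have hη := eta_nonneg hO.radius_nonneg
  have hβ := beta_le_pi (N := N) (by linarith)
  refine hO.closedBall_subset_of_angle hc (div_pos (by linarith) (by linarith)) (by linarith)
    fun u hu ε hε => ?_
  obtain ⟨l, h3, h3', h4⟩ := hO.exists_long_free_angle_le hm hN2 hu hε
  obtain ⟨s, h5, h6, h7⟩ := hO.mem_slice_of_le_norm hc h3 hN3 h3'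
  exact ⟨l, s, h4, h5, h6, h7, h3.1⟩

/-- Once the admissible rotation set contains a nontrivial ball around the origin, it contains a
largest one. -/
lemma exists_isGreatest_radius (hm : 2 ≤ m) {ρ₀ : ℝ} (hρ₀ : 0 < ρ₀)
    (h : Metric.closedBall 0 ρ₀ ⊆ admissibleRotationSet O) :
    ∃ ρ : ℝ, IsGreatest {s : ℝ | 0 ≤ s ∧ Metric.closedBall 0 s ⊆ admissibleRotationSet O} ρ ∧
      ρ₀ ≤ ρ ∧ ρ ≤ 1 := by
  obtain ⟨c, hc⟩ := exists_unit hm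
  have hone : ∀ s ∈ {s : ℝ | 0 ≤ s ∧ Metric.closedBall 0 s ⊆ admissibleRotationSet O}, s ≤ 1 := by
    rintro s ⟨hs0, hs⟩
    have hn : ‖s • intVec c‖ = s := by
      rw [norm_smul, norm_intVec_of_unit hc, Real.norm_of_nonneg hs0, mul_one]
    have := norm_le_one_of_mem_admissibleRotationSet
      (hs (show s • intVec c ∈ Metric.closedBall 0 s by simp [hn]))
    rwa [hn] at this
  have hmem : ρ₀ ∈ {s : ℝ | 0 ≤ s ∧ Metric.closedBall 0 s ⊆ admissibleRotationSet O} :=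
    ⟨hρ₀.le, h⟩
  have hbdd : BddAbove {s : ℝ | 0 ≤ s ∧ Metric.closedBall 0 s ⊆ admissibleRotationSet O} :=
    ⟨1, hone⟩
  have hle := le_csSup hbdd hmem
  have hpos := hρ₀.trans_le hle
  refine ⟨_, ⟨⟨hpos.le, ?_⟩, fun s hs => le_csSup hbdd hs⟩, hle, csSup_le ⟨_, hmem⟩ hone⟩
  -- The open ball of the supremal radius is covered by smaller admissible balls; closedness of the
  -- rotation set adds the boundary.
  rw [← closure_ball _ hpos.ne']
  refine closure_minimal (fun v hv => ?_) (isClosed_admissibleRotationSet O)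
  obtain ⟨s, hs, hvs⟩ := exists_lt_of_lt_csSup ⟨_, hmem⟩ (mem_ball_zero_iff.1 hv)
  exact hs.2 (mem_closedBall_zero_iff.2 hvs.le)

theorem exists_largest_ball_near_one {ε : ℝ} (hε : 0 < ε) :
    ∃ δ : ℝ, 0 < δ ∧ ∀ m : ℕ, 2 ≤ m → ∀ O : Set (EuclideanSpace ℝ (Fin m)), IsObstacle O →
      Metric.diam O < δ → ∃ ρ : ℝ,
        IsGreatest {s : ℝ | 0 ≤ s ∧ Metric.closedBall 0 s ⊆ admissibleRotationSet O} ρ ∧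
          |ρ - 1| < ε := by
  set ε' := min ε 1 with hε'
  have hε0 : 0 < ε' := lt_min hε one_pos
  have hpi := Real.pi_pos
  obtain ⟨K, hK⟩ := exists_nat_gt (4 / ε')
  rw [div_lt_iff₀ hε0] at hK
  obtain ⟨r₀, hr₀, hN⟩ := exists_isNOf K
  -- This `r` serves as `δ`, since a set of diameter less than `r` lies in the `r`-ball about any of
  -- its points. The last bound gives `2 * eta r ≤ ε' / 4`, and `K > 4 / ε'` gives `2 / (N + 1) ≤ ε'
  -- / 2`, so the product of the two factors exceeds `1 - ε'`.
  obtain ⟨r, hr0, hr1, hr2, hr3⟩ : ∃ r : ℝ, 0 < r ∧ r < r₀ ∧ r ≤ 1 / 4 ∧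
      r ≤ ε' / (16 * Real.pi) := by
    refine ⟨min (r₀ / 2) (min (1 / 4) (ε' / (16 * Real.pi))), by positivity, ?_, ?_, ?_⟩
    · exact (min_le_left _ _).trans_lt (by linarith)
    · exact (min_le_right _ _).trans (min_le_left _ _)
    · exact (min_le_right _ _).trans (min_le_right _ _)
  rw [le_div_iff₀ (by positivity)] at hr3
  refine ⟨r, hr0, fun m hm O hO hd => ?_⟩
  obtain ⟨N, hNr, hKN⟩ := hN r hr0 hr1
  obtain ⟨z, hz⟩ := hO.interior_nonempty.mono interior_subset
  have h2 : 1 < √2 := by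
    rw [Real.lt_sqrt one_pos.le]; norm_num
  have hsub : O ⊆ Metric.closedBall z r := fun x hx =>
    (Metric.dist_le_diam_of_mem hO.isCompact.isBounded hx hz).trans hd.le
  have hball := (hO.smallBody (by linarith) hsub).closedBall_subset_cos_two_mul_eta hm hNr
  have hη0 := eta_nonneg hr0.le
  have hη : 2 * eta r ≤ ε' / 4 := by linarith [eta_le hr0.le]
  have hcos : 1 - ε' / 4 ≤ Real.cos (2 * eta r) := by
    have := (abs_le.1 (Real.abs_cos_sub_cos_le (2 * eta r) 0)).1
    rw [Real.cos_zero, sub_zero, abs_of_nonneg (by linarith)] at this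
    linarith
  have hKN' : (K : ℝ) ≤ N := by exact_mod_cast hKN
  have hfrac : 1 - ε' / 2 ≤ ((N : ℝ) - 1) / ((N : ℝ) + 1) := by
    rw [le_div_iff₀ (by positivity)]
    nlinarith
  have hε1 : ε' ≤ 1 := min_le_right _ _
  have hε2 : ε' ≤ ε := min_le_left _ _
  have hρ₀ : 1 - ε' < ((N : ℝ) - 1) / ((N : ℝ) + 1) * Real.cos (2 * eta r) := by
    have := mul_le_mul hfrac hcos (by linarith) (by linarith)
    nlinarith
  obtain ⟨ρ, h3, h4, h5⟩ := exists_isGreatest_radius hm (by linarith) hball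
  exact ⟨ρ, h3, abs_lt.2 ⟨by linarith, by linarith⟩⟩

end

end TorusBilliard

theorem mainTheorem7 :
    -- the first explicit ball
    (∀ (m : ℕ), 2 ≤ m → ∀ (O : Set (EuclideanSpace ℝ (Fin m))), TorusBilliard.IsObstacle O →
      ∀ (z : EuclideanSpace ℝ (Fin m)) (r : ℝ), r < √2 / 4 → O ⊆ Metric.closedBall z r →
        Metric.closedBall 0 ((1 - √2 / 2) * Real.cos (TorusBilliard.eta r)) ⊆
          TorusBilliard.admissibleRotationSet O) ∧
    -- the second explicit ball, whenever `N(r)` is defined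
    (∀ (m : ℕ), 2 ≤ m → ∀ (O : Set (EuclideanSpace ℝ (Fin m))), TorusBilliard.IsObstacle O →
      ∀ (z : EuclideanSpace ℝ (Fin m)) (r : ℝ), r < √2 / 4 → O ⊆ Metric.closedBall z r →
        ∀ N : ℕ, TorusBilliard.IsNOf r N →
          Metric.closedBall 0
              ((((N : ℝ) - 1) / ((N : ℝ) + 1)) * Real.cos (2 * TorusBilliard.eta r)) ⊆
            TorusBilliard.admissibleRotationSet O) ∧
    -- `N(r)` is defined for all sufficiently small `r`, and tends to infinity as `r → 0`
    (∀ K : ℕ, ∃ r₀ : ℝ, 0 < r₀ ∧ ∀ r : ℝ, 0 < r → r < r₀ →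
      ∃ N : ℕ, TorusBilliard.IsNOf r N ∧ K ≤ N) ∧
    -- the radius of the largest ball centered at the origin and contained in the admissible
    -- rotation set tends to 1, uniformly in `m`, as the diameter of the obstacle tends to 0
    (∀ ε : ℝ, 0 < ε → ∃ δ : ℝ, 0 < δ ∧
      ∀ (m : ℕ), 2 ≤ m → ∀ (O : Set (EuclideanSpace ℝ (Fin m))), TorusBilliard.IsObstacle O →
        Metric.diam O < δ →
          ∃ ρ : ℝ,
            IsGreatest
              {s : ℝ | 0 ≤ s ∧
                Metric.closedBall 0 s ⊆ TorusBilliard.admissibleRotationSet O} ρ ∧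
            |ρ - 1| < ε) := by
  refine ⟨fun m hm O hO z r hr hz => ?_, fun m hm O hO z r hr hz N hN => ?_,
    TorusBilliard.exists_isNOf, fun ε hε => TorusBilliard.exists_largest_ball_near_one hε⟩
  · exact (hO.smallBody hr hz).closedBall_subset_cos_eta hm
  · exact (hO.smallBody hr hz).closedBall_subset_cos_two_mul_eta hm hN
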